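/- Let $m,n,r_1,r_2$ be integers with $0<r_1<m$ and $0<r_2<n$, and let $\Lambda\in\mathbb{R}^{m\times m}$, $\Psi\in\mathbb{R}^{n\times n}$. Suppose that $\Lambda$ and $\Psi$ each have a semisimple unit eigenvalue, of algebraic multiplicity $m-r_1$ and $n-r_2$ respectively, and that all their other (complex) eigenvalues lie strictly inside the unit disk. Let $(E_t)_{t\in\mathbb{Z}}$ be an $m\times n$ matrix white noise: square integrable, of mean zero, uncorrelated over time, with $\operatorname{Var}(\operatorname{vec}E_t)=\Sigma$ positive definite and independent of $t$. Let $(X_t)_{t\ge 0}$ satisfy $X_t=\Lambda X_{t-1}\Psi'+E_t$ for $t\ge 1$, with square integrable initial value $X_0$. Conventions (as in Johansen). A process $y_t$ is $I(0)$ if $y_t-c=\sum_{i\ge0}C_i\operatorname{vec}(E_{t-i})$ in mean square for a constant vector $c$ and geometrically decaying matrices $C_i$ with $\sum_i C_i\ne 0$; $x_t$ is $I(1)$ if $\Delta x_t$ is $I(0)$. The vectors $b$ for which $b'\operatorname{vec}(X_t)$ can be made (weakly) stationary by a suitable choice of a square integrable initial value $X_0$ form the cointegration space, and the cointegration rank is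 its dimension. A process $x_t$ has $k$ common stochastic trends if $x_t=A\tau_t+s_t$ with $A$ of full column rank $k$, $\tau_t$ a $k$-dimensional random walk whose increments are white noise with positive definite covariance, and $s_t$ weakly stationary. Then $\operatorname{vec}(X_t)$ is an $I(1)$ cointegrated process with $(m-r_1)(n-r_2)$ common stochastic trends and cointegration rank $$mn-(m-r_1)(n-r_2)=nr_1+mr_2-r_1r_2>0.$$ Precisely: 1. There is a square integrable initial value $\tilde X_0$ such that the solution $\tilde X_t$ of the same equation started from it satisfies $E\|X_t-\tilde X_t\|^2\to0$, $\operatorname{vec}(\tilde X_t)$ is $I(1)$ and has $(m-r_1)(n-r_2)$ common stochastic trends, and $b'\operatorname{vec}(\tilde X_t)$ is $I(0)$ for every nonzero $b$ in the cointegration space. 2. The cointegration space is a linear space of dimension $mn-(m-r_1)(n-r_2)$, and this number is also the rank of the impact matrix $\Psi\otimes\Lambda-I_{mn}$ in $\Delta\operatorname{vec}(X_t)=(\Psi\otimes\Lambda-I_{mn})\operatorname{vec}(X_{t-1})+\operatorname{vec}(E_t)$. -/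

import Mathlib

open MeasureTheory ProbabilityTheory Filter Topology
open scoped Matrix Kronecker

/-- The real matrix `A` has a semisimple unit eigenvalue of algebraic multiplicity `k`: the number `1`
is a root of multiplicity `k` of the characteristic polynomial, and its geometric multiplicity
is `k` too. -/
def HasSemisimpleUnitEigenvalue {d : ℕ} (A : Matrix (Fin d) (Fin d) ℝ) (k : ℕ) : Prop :=
  A.charpoly.rootMultiplicity 1 = k ∧
    Module.finrank ℝ (Module.End.eigenspace (Matrix.toLin' A) 1) = k

/-- Every complex eigenvalue of the real matrix `A` other than `1` lies strictly inside the unit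
disk. -/
def OtherEigenvaluesStable {d : ℕ} (A : Matrix (Fin d) (Fin d) ℝ) : Prop :=
  ∀ z ∈ spectrum ℂ (A.map (algebraMap ℝ ℂ)), z ≠ 1 → ‖z‖ < 1

/-- The vectorization of a matrix-valued process (columns stacked; the entry in row `i` and
column `j` has index `(j, i)`). -/
def vecProcess {T Ω : Type*} {m n : ℕ} (X : T → Ω → Matrix (Fin m) (Fin n) ℝ) :
    T → Ω → (Fin n × Fin m → ℝ) :=
  fun t ω => (X t ω).vec

section Processes

variable {Ω : Type*} [MeasurableSpace Ω]

/-- Vector white noise: square integrable, centred, uncorrelated over time, with a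
contemporaneous covariance matrix that is positive definite and does not depend on time. -/
def IsWhiteNoise {T ι : Type*} [Fintype ι] (μ : Measure Ω) (e : T → Ω → (ι → ℝ)) : Prop :=
  (∀ t, MemLp (e t) 2 μ) ∧
  (∀ t a, ∫ ω, e t ω a ∂μ = 0) ∧
  (∃ S : Matrix ι ι ℝ, S.PosDef ∧
    ∀ t a b, covariance (fun ω => e t ω a) (fun ω => e t ω b) μ = S a b) ∧
  (∀ s t, s ≠ t → ∀ a b, covariance (fun ω => e s ω a) (fun ω => e t ω b) μ = 0)

/-- `X` is a matrix autoregressive process of order one, started at time `0` from a square integrable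
random matrix: `X_t = Λ X_{t-1} Ψ' + E_t` for `t ≥ 1`. -/
def IsMAR1 {m n : ℕ} (μ : Measure Ω) (Λ : Matrix (Fin m) (Fin m) ℝ) (Ψ : Matrix (Fin n) (Fin n) ℝ)
    (E : ℤ → Ω → Matrix (Fin m) (Fin n) ℝ) (X : ℕ → Ω → Matrix (Fin m) (Fin n) ℝ) : Prop :=
  MemLp (vecProcess X 0) 2 μ ∧
  ∀ t : ℕ, ∀ᵐ ω ∂μ, X (t + 1) ω = Λ * X t ω * Ψᵀ + E (t + 1) ω

/-- Weak (second-order) stationarity. -/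
def IsWeaklyStationary {ι : Type*} [Fintype ι] (μ : Measure Ω) (y : ℕ → Ω → (ι → ℝ)) : Prop :=
  (∀ t, MemLp (y t) 2 μ) ∧
  (∀ t a, ∫ ω, y t ω a ∂μ = ∫ ω, y 0 ω a ∂μ) ∧
  (∀ t h a b, covariance (fun ω => y t ω a) (fun ω => y (t + h) ω b) μ =
    covariance (fun ω => y 0 ω a) (fun ω => y h ω b) μ)

/-- `y` is integrated of order zero, with innovations the white noise `e`: up to a constant mean,
`y_t = ∑_{i ≥ 0} C_i e_{t-i}` in mean square, where the coefficients decay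
geometrically and their sum is not zero. -/
def IsI0 {ι κ : Type*} [Fintype ι] [Fintype κ] (μ : Measure Ω) (e : ℤ → Ω → (ι → ℝ))
    (y : ℕ → Ω → (κ → ℝ)) : Prop :=
  ∃ (c : κ → ℝ) (C : ℕ → Matrix κ ι ℝ),
    (∃ M ρ : ℝ, 0 ≤ ρ ∧ ρ < 1 ∧ ∀ i a b, |C i a b| ≤ M * ρ ^ i) ∧
    (∑' i, C i) ≠ 0 ∧
    ∀ t : ℕ, Tendsto
      (fun N : ℕ => eLpNorm
        (fun ω => y t ω - c - ∑ i ∈ Finset.range N, C i *ᵥ e ((t : ℤ) - (i : ℤ)) ω) 2 μ)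
      atTop (𝓝 0)

/-- `x` is integrated of order one: its first difference is integrated of order zero. The
difference `x_{t+1} - x_t` is dated `t + 1`, hence the shift of the innovations. -/
def IsI1 {ι κ : Type*} [Fintype ι] [Fintype κ] (μ : Measure Ω) (e : ℤ → Ω → (ι → ℝ))
    (x : ℕ → Ω → (κ → ℝ)) : Prop :=
  IsI0 μ (fun t => e (t + 1)) (fun t ω => x (t + 1) ω - x t ω)

/-- The linear combination `b' x_t`, as a process with a single coordinate. -/
def linComb {ι : Type*} [Fintype ι] (b : ι → ℝ) (x : ℕ → Ω → (ι → ℝ)) :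
    ℕ → Ω → (Unit → ℝ) :=
  fun t ω _ => b ⬝ᵥ x t ω

/-- The vectors `b` for which `b' x_t` can be made stationary by a suitable choice of
the initial value; `sol` is the set of the processes that solve the model, one for each initial
value. -/
def cointegratingVectors {ι : Type*} [Fintype ι] (μ : Measure Ω)
    (sol : Set (ℕ → Ω → (ι → ℝ))) : Set (ι → ℝ) :=
  {b | ∃ x ∈ sol, IsWeaklyStationary μ (linComb b x)}

/-- The cointegration rank is `r`: the cointegrating vectors, with zero, form a linear space of
dimension `r`. -/
def HasCointegrationRank {ι : Type*} [Fintype ι] (μ : Measure Ω)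
    (sol : Set (ℕ → Ω → (ι → ℝ))) (r : ℕ) : Prop :=
  ∃ S : Submodule ℝ (ι → ℝ), (S : Set (ι → ℝ)) = cointegratingVectors μ sol ∧
    Module.finrank ℝ S = r

/-- `x` has `k` common stochastic trends: `x_t = A τ_t + s_t`, where `A` has
full column rank `k`, `τ` is a `k`-dimensional random walk with white-noise increments of
positive definite covariance, and `s` is stationary. -/
def HasCommonTrends {ι : Type*} [Fintype ι] (μ : Measure Ω)
    (x : ℕ → Ω → (ι → ℝ)) (k : ℕ) : Prop :=
  ∃ (A : Matrix ι (Fin k) ℝ) (τ u : ℕ → Ω → (Fin k → ℝ)) (s : ℕ → Ω → (ι → ℝ)),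
    A.rank = k ∧
    MemLp (τ 0) 2 μ ∧
    (∀ t, ∀ᵐ ω ∂μ, τ (t + 1) ω = τ t ω + u t ω) ∧
    IsWhiteNoise μ u ∧
    IsWeaklyStationary μ s ∧
    ∀ t, ∀ᵐ ω ∂μ, x t ω = A *ᵥ τ t ω + s t ω

end Processes

/-! Vectorization turns the model into the first-order vector autoregression with matrix `A = Ψ ⊗ₖ
Λ`. Each factor has powers that converge geometrically to the spectral projection `L * R` of its
semisimple unit eigenvalue (`exists_isUnitSplitting`). This property is inherited by Kronecker
products (`IsUnitSplitting.kronecker`), with ranks multiplying, so `A` has a projection `L * R` of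
rank `(m - r₁) * (n - r₂)`.

The identity `x = L (R x) + (1 - L R) x` then separates trends from equilibria. Since `R A = R`, the
process `R x` is a random walk with increments `R e`. On the complement `A` is stable, so the
stationary moving average of past noise exists there. Starting `(1 - L R) x` from it while keeping
`R x₀` gives a solution that differs from the given one by a decaying transient
(`IsUnitSplitting.exists_isEquilibriumSolution`, `IsEquilibriumSolution.tendsto_sub`).

The cointegrating vectors are exactly those with `b' L = 0`. For such `b` the trend drops out.
Conversely, stationarity of `b' y` for any solution `y` bounds the random walk `b' L R y` in mean
square, whereas the variance of its accumulated increments grows linearly unless `b' L R = 0`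
(`IsWhiteNoise.eq_zero_of_bounded_sum`). Both ranks follow by rank-nullity. -/

/-! ### Geometric decay of matrix sequences -/

/-- The entries of the matrices `C i` decay geometrically. -/
def DecaysGeometrically {α β : Type*} (C : ℕ → Matrix α β ℝ) : Prop :=
  ∃ M ρ : ℝ, 0 ≤ ρ ∧ ρ < 1 ∧ ∀ i a b, |C i a b| ≤ M * ρ ^ i

namespace DecaysGeometrically

variable {α β γ δ : Type*} {C D : ℕ → Matrix α β ℝ}

theorem exists_pos (hC : DecaysGeometrically C) :
    ∃ M ρ : ℝ, 0 ≤ M ∧ 0 ≤ ρ ∧ ρ < 1 ∧ ∀ i a b, |C i a b| ≤ M * ρ ^ i := by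
  obtain ⟨M, ρ, h0, h1, h⟩ := hC
  refine ⟨|M|, ρ, abs_nonneg M, h0, h1, fun i a b => (h i a b).trans ?_⟩
  gcongr
  exact le_abs_self M

theorem add (hC : DecaysGeometrically C) (hD : DecaysGeometrically D) :
    DecaysGeometrically fun i => C i + D i := by
  obtain ⟨M, ρ, hM, h0, h1, h⟩ := hC.exists_pos
  obtain ⟨M', ρ', hM', h0', h1', h'⟩ := hD.exists_pos
  refine ⟨M + M', max ρ ρ', le_max_of_le_left h0, max_lt h1 h1', fun i a b => ?_⟩
  calc |C i a b + D i a b| ≤ |C i a b| + |D i a b| := abs_add_le _ _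
    _ ≤ M * ρ ^ i + M' * ρ' ^ i := add_le_add (h i a b) (h' i a b)
    _ ≤ M * max ρ ρ' ^ i + M' * max ρ ρ' ^ i := by
        gcongr
        · exact le_max_left _ _
        · exact le_max_right _ _
    _ = _ := by ring

theorem mul_left [Fintype α] [Finite γ] (B : Matrix γ α ℝ) (hC : DecaysGeometrically C) :
    DecaysGeometrically fun i => B * C i := by
  obtain ⟨M, ρ, hM, h0, h1, h⟩ := hC.exists_pos
  have := Fintype.ofFinite γ
  refine ⟨(∑ p : γ × α, |B p.1 p.2|) * M, ρ, h0, h1, fun i a b => ?_⟩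
  dsimp only
  rw [Matrix.mul_apply, mul_assoc, Fintype.sum_prod_type, Finset.sum_mul]
  calc |∑ j, B a j * C i j b| ≤ ∑ j, |B a j| * |C i j b| := by
        simpa only [abs_mul] using Finset.abs_sum_le_sum_abs (fun j => B a j * C i j b) _
    _ ≤ ∑ j, |B a j| * (M * ρ ^ i) := by
        gcongr with j
        exact h i j b
    _ = (∑ j, |B a j|) * (M * ρ ^ i) := by rw [Finset.sum_mul]
    _ ≤ _ := Finset.single_le_sum (f := fun a => (∑ j, |B a j|) * (M * ρ ^ i))
        (fun a _ => by positivity) (Finset.mem_univ a)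

theorem kronecker {D : ℕ → Matrix γ δ ℝ} (hC : DecaysGeometrically C)
    (hD : DecaysGeometrically D) : DecaysGeometrically fun i => C i ⊗ₖ D i := by
  obtain ⟨M, ρ, hM, h0, h1, h⟩ := hC.exists_pos
  obtain ⟨M', ρ', hM', h0', h1', h'⟩ := hD.exists_pos
  refine ⟨M * M', ρ * ρ', by positivity, mul_lt_one_of_nonneg_of_lt_one_left h0 h1 h1'.le,
    fun i ⟨a, a'⟩ ⟨b, b'⟩ => ?_⟩
  dsimp only
  rw [Matrix.kroneckerMap_apply, abs_mul]
  calc _ ≤ (M * ρ ^ i) * (M' * ρ' ^ i) :=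
        mul_le_mul (h _ _ _) (h' _ _ _) (abs_nonneg _) (by positivity)
    _ = _ := by rw [mul_pow]; ring

theorem kronecker_const [Finite γ] [Finite δ] (B : Matrix γ δ ℝ) (hC : DecaysGeometrically C) :
    DecaysGeometrically fun i => C i ⊗ₖ B := by
  obtain ⟨M, ρ, hM, h0, h1, h⟩ := hC.exists_pos
  have := Fintype.ofFinite γ
  have := Fintype.ofFinite δ
  refine ⟨M * ∑ p : γ × δ, |B p.1 p.2|, ρ, h0, h1, fun i ⟨a, a'⟩ ⟨b, b'⟩ => ?_⟩
  dsimp only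
  rw [Matrix.kroneckerMap_apply, abs_mul]
  calc _ ≤ (M * ρ ^ i) * ∑ p : γ × δ, |B p.1 p.2| := by
        gcongr
        · exact h _ _ _
        · exact Finset.single_le_sum (f := fun p : γ × δ => |B p.1 p.2|)
            (fun _ _ => abs_nonneg _) (Finset.mem_univ (a', b'))
    _ = _ := by ring

theorem const_kronecker [Finite γ] [Finite δ] (B : Matrix γ δ ℝ) (hC : DecaysGeometrically C) :
    DecaysGeometrically fun i => B ⊗ₖ C i := by
  obtain ⟨M, ρ, h0, h1, h⟩ := hC.kronecker_const B
  refine ⟨M, ρ, h0, h1, fun i ⟨a, a'⟩ ⟨b, b'⟩ => ?_⟩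
  have := h i (a', a) (b', b)
  dsimp only at this ⊢
  rw [Matrix.kroneckerMap_apply] at this ⊢
  rwa [mul_comm]

/-- Finitely many exceptional terms are absorbed by a constant, possibly at a different rate below
one. -/
theorem of_eventually_le {f : ℕ → Matrix α β ℝ} (g : ℕ → ℝ)
    (hfg : ∀ i a b, |f i a b| ≤ g i) {ρ : ℝ} (h1 : ρ < 1)
    (hg : ∀ᶠ i in atTop, |g i| ≤ ρ ^ i) : DecaysGeometrically f := by
  obtain ⟨a, ha, C, -, h⟩ := ((TFAE_exists_lt_isLittleO_pow g 1).out 6 5 :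
    (∃ a < 1, ∀ᶠ n in atTop, |g n| ≤ a ^ n) ↔ _).1 ⟨ρ, h1, hg⟩
  exact ⟨C, a, ha.1.le, ha.2, fun i x y => (hfg i x y).trans ((le_abs_self _).trans (h i))⟩

theorem of_tail (hC : DecaysGeometrically fun i => C (i + 1)) {M₀ : ℝ}
    (h₀ : ∀ a b, |C 0 a b| ≤ M₀) : DecaysGeometrically C := by
  obtain ⟨M, ρ, hM, h0, h1, h⟩ := hC.exists_pos
  -- Shifting the index divides by the rate, which may be zero; the maximum with `1 / 2` keeps it
  -- positive.
  set σ : ℝ := max ρ (1 / 2) with hσ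
  have hσ0 : 0 < σ := lt_max_of_lt_right (by norm_num)
  refine ⟨max M₀ (M / σ), σ, hσ0.le, max_lt h1 (by norm_num), fun i a b => ?_⟩
  rcases i with _ | i
  · simpa using Or.inl (h₀ a b)
  · calc |C (i + 1) a b| ≤ M * ρ ^ i := h i a b
      _ ≤ M * σ ^ i := by gcongr; exact le_max_left _ _
      _ = M / σ * σ ^ (i + 1) := by rw [pow_succ]; field_simp
      _ ≤ _ := by gcongr; exact le_max_right _ _

theorem tendsto_zero (hC : DecaysGeometrically C) : Tendsto C atTop (𝓝 0) := by
  obtain ⟨M, ρ, hM, h0, h1, h⟩ := hC.exists_pos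
  refine tendsto_pi_nhds.2 fun a => tendsto_pi_nhds.2 fun b => ?_
  refine squeeze_zero_norm (fun i => h i a b) ?_
  simpa using (tendsto_pow_atTop_nhds_zero_of_lt_one h0 h1).const_mul M

theorem summable (hC : DecaysGeometrically C) : Summable C := by
  obtain ⟨M, ρ, hM, h0, h1, h⟩ := hC.exists_pos
  refine Pi.summable.2 fun a => Pi.summable.2 fun b => ?_
  exact Summable.of_norm_bounded ((summable_geometric_of_lt_one h0 h1).mul_left M)
    fun i => h i a b

end DecaysGeometrically

/-! ### Powers of a stable matrix -/

section Spectral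

attribute [local instance] Matrix.linftyOpNormedRing Matrix.linftyOpNormedAlgebra

theorem Matrix.norm_entry_le_linftyOpNorm {d : ℕ} (A : Matrix (Fin d) (Fin d) ℂ) (a b : Fin d) :
    ‖A a b‖ ≤ ‖A‖ := by
  rw [Matrix.linfty_opNorm_def]
  have h1 : ‖A a b‖₊ ≤ ∑ j, ‖A a j‖₊ :=
    Finset.single_le_sum (f := fun j => ‖A a j‖₊) (fun _ _ => zero_le) (Finset.mem_univ b)
  have h2 : ∑ j, ‖A a j‖₊ ≤ Finset.univ.sup fun i => ∑ j, ‖A i j‖₊ :=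
    Finset.le_sup (f := fun i => ∑ j, ‖A i j‖₊) (Finset.mem_univ a)
  exact_mod_cast h1.trans h2

/-- The powers of a matrix with all its eigenvalues in the open unit disk decay geometrically. -/
theorem DecaysGeometrically.pow_of_spectrum_lt_one {d : ℕ} (N : Matrix (Fin d) (Fin d) ℝ)
    (hN : ∀ z ∈ spectrum ℂ (N.map (algebraMap ℝ ℂ)), ‖z‖ < 1) :
    DecaysGeometrically fun i => N ^ i := by
  rcases isEmpty_or_nonempty (Fin d) with hd | hd
  · exact ⟨0, 0, le_rfl, one_pos, fun i a => hd.elim a⟩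
  set B := N.map (algebraMap ℝ ℂ) with hB
  have : CompleteSpace (Matrix (Fin d) (Fin d) ℂ) := FiniteDimensional.complete ℂ _
  have hr : spectralRadius ℂ B < ((1 : NNReal) : ENNReal) :=
    spectrum.spectralRadius_lt_of_forall_lt B fun z hz => by exact_mod_cast hN z hz
  obtain ⟨ρ, hρ, hρ1⟩ := ENNReal.lt_iff_exists_nnreal_btwn.1 hr
  -- Gelfand's formula: the `i`-th roots of `‖B ^ i‖` eventually lie below any `ρ` above the
  -- spectral radius.
  have hev := (spectrum.pow_nnnorm_pow_one_div_tendsto_nhds_spectralRadius B).eventually_lt_const hρ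
  refine DecaysGeometrically.of_eventually_le (fun i => ‖B ^ i‖) (fun i a b => ?_)
    (ρ := ρ) (by exact_mod_cast hρ1) ?_
  · have h := Matrix.norm_entry_le_linftyOpNorm (B ^ i) a b
    rw [hB, ← Matrix.map_pow, Matrix.map_apply] at h
    rw [hB, ← Matrix.map_pow]
    simpa using h
  · filter_upwards [hev, eventually_gt_atTop 0] with i hi hi0
    rw [abs_of_nonneg (norm_nonneg _)]
    have h2 := ENNReal.rpow_le_rpow hi.le (Nat.cast_nonneg (α := ℝ) i)
    rw [← ENNReal.rpow_mul, one_div_mul_cancel (by positivity), ENNReal.rpow_one,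
      ENNReal.rpow_natCast] at h2
    exact_mod_cast h2

end Spectral

/-! ### Splitting off a semisimple unit eigenvalue -/

/-- `L` and `R` are dual bases of the right and left eigenspaces of `A` for the eigenvalue `1`,
and the powers of `A` converge geometrically to the spectral projection `L * R`. -/
structure IsUnitSplitting {ι κ : Type*} [Fintype ι] [DecidableEq ι] [Fintype κ] [DecidableEq κ]
    (A : Matrix ι ι ℝ) (L : Matrix ι κ ℝ) (R : Matrix κ ι ℝ) : Prop where
  right_mul_left : R * L = 1
  mul_left : A * L = L
  right_mul : R * A = R
  decay : DecaysGeometrically fun i => A ^ i - L * R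

namespace IsUnitSplitting

variable {ι κ : Type*} [Fintype ι] [DecidableEq ι] [Fintype κ] [DecidableEq κ]
  {A : Matrix ι ι ℝ} {L : Matrix ι κ ℝ} {R : Matrix κ ι ℝ}

theorem pow_mul_left (h : IsUnitSplitting A L R) (i : ℕ) : A ^ i * L = L := by
  induction i with
  | zero => simp
  | succ i ih => rw [pow_succ, Matrix.mul_assoc, h.mul_left, ih]

theorem left_mul_pow (h : IsUnitSplitting A L R) (i : ℕ) : R * A ^ i = R := by
  induction i with
  | zero => simp
  | succ i ih => rw [pow_succ, ← Matrix.mul_assoc, ih, h.right_mul]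

theorem pow_mul_compl (h : IsUnitSplitting A L R) (i : ℕ) :
    A ^ i * (1 - L * R) = A ^ i - L * R := by
  rw [Matrix.mul_sub, Matrix.mul_one, ← Matrix.mul_assoc, h.pow_mul_left]

theorem compl_mul_pow (h : IsUnitSplitting A L R) (i : ℕ) :
    (1 - L * R) * A ^ i = A ^ i - L * R := by
  rw [Matrix.sub_mul, Matrix.one_mul, Matrix.mul_assoc, h.left_mul_pow]

theorem right_mul_compl (h : IsUnitSplitting A L R) : R * (1 - L * R) = 0 := by
  rw [Matrix.mul_sub, Matrix.mul_one, ← Matrix.mul_assoc, h.right_mul_left, Matrix.one_mul,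
    sub_self]

theorem compl_mul_left (h : IsUnitSplitting A L R) : (1 - L * R) * L = 0 := by
  rw [Matrix.sub_mul, Matrix.one_mul, Matrix.mul_assoc, h.right_mul_left, Matrix.mul_one,
    sub_self]

theorem compl_mul_compl (h : IsUnitSplitting A L R) :
    (1 - L * R) * (1 - L * R) = 1 - L * R := by
  rw [Matrix.sub_mul, Matrix.mul_assoc, h.right_mul_compl, Matrix.mul_zero, sub_zero,
    Matrix.one_mul]

theorem decay_mul_compl (h : IsUnitSplitting A L R) :
    DecaysGeometrically fun i => A ^ i * (1 - L * R) := by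
  simpa only [h.pow_mul_compl] using h.decay

theorem sub_one_mul_compl (h : IsUnitSplitting A L R) : (A - 1) * (1 - L * R) = A - 1 := by
  have := h.pow_mul_compl 1
  rw [pow_one] at this
  rw [Matrix.sub_mul, this, Matrix.one_mul]
  abel

theorem rank_left (h : IsUnitSplitting A L R) : L.rank = Fintype.card κ := by
  refine le_antisymm L.rank_le_card_width ?_
  calc Fintype.card κ = (R * L).rank := by rw [h.right_mul_left, Matrix.rank_one]
    _ ≤ L.rank := Matrix.rank_mul_le_right R L

/-- A fixed vector of `A` lies in the range of the projection. -/
theorem mulVec_eq_self (h : IsUnitSplitting A L R) {x : ι → ℝ} (hx : A *ᵥ x = x) :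
    (L * R) *ᵥ x = x := by
  have hpow : ∀ i : ℕ, A ^ i *ᵥ x = x := fun i => by
    induction i with
    | zero => simp
    | succ i ih => rw [pow_succ, ← Matrix.mulVec_mulVec, hx, ih]
  -- The sequence is constant, equal to `x - L R x`, yet it tends to zero.
  have h1 : Tendsto (fun i : ℕ => (A ^ i - L * R) *ᵥ x) atTop (𝓝 ((0 : Matrix ι ι ℝ) *ᵥ x)) :=
    ((continuous_id.matrix_mulVec continuous_const).tendsto _).comp h.decay.tendsto_zero
  simp only [Matrix.sub_mulVec, hpow, Matrix.zero_mulVec] at h1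
  exact (sub_eq_zero.1 (tendsto_nhds_unique tendsto_const_nhds h1)).symm

/-- The kernel of `A - 1` is the column space of `L`, so this is rank-nullity; it yields the rank of
the impact matrix. -/
theorem rank_sub_one_add (h : IsUnitSplitting A L R) :
    (A - 1).rank + Fintype.card κ = Fintype.card ι := by
  have hker : LinearMap.ker (A - 1).mulVecLin = LinearMap.range L.mulVecLin := by
    ext x
    simp only [LinearMap.mem_ker, Matrix.mulVecLin_apply, LinearMap.mem_range]
    constructor
    · intro hx
      rw [Matrix.sub_mulVec, Matrix.one_mulVec, sub_eq_zero] at hx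
      exact ⟨R *ᵥ x, by rw [Matrix.mulVec_mulVec, h.mulVec_eq_self hx]⟩
    · rintro ⟨y, rfl⟩
      rw [Matrix.mulVec_mulVec, Matrix.sub_mul, h.mul_left, Matrix.one_mul, sub_self,
        Matrix.zero_mulVec]
  have hrn := LinearMap.finrank_range_add_finrank_ker (A - 1).mulVecLin
  rw [hker, Module.finrank_fintype_fun_eq_card] at hrn
  rw [← h.rank_left]
  exact hrn

/-- The vectors orthogonal to the columns of `L` form a space of complementary dimension. -/
theorem finrank_ker_transpose_add (h : IsUnitSplitting A L R) :
    Module.finrank ℝ (LinearMap.ker Lᵀ.mulVecLin) + Fintype.card κ = Fintype.card ι := by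
  have hrn := LinearMap.finrank_range_add_finrank_ker Lᵀ.mulVecLin
  have hr : Module.finrank ℝ (LinearMap.range Lᵀ.mulVecLin) = Fintype.card κ := by
    rw [← h.rank_left, ← Matrix.rank_transpose L]
    rfl
  rw [hr, Module.finrank_fintype_fun_eq_card] at hrn
  omega

theorem reindex {κ' : Type*} [Fintype κ'] [DecidableEq κ'] (h : IsUnitSplitting A L R)
    (e : κ' ≃ κ) : IsUnitSplitting A (L.submatrix id e) (R.submatrix e id) where
  right_mul_left := by
    rw [← Matrix.submatrix_mul _ _ _ _ _ Function.bijective_id, h.right_mul_left,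
      Matrix.submatrix_one_equiv]
  mul_left := by
    have := congrArg (fun B => B.submatrix id e) h.mul_left
    simpa [Matrix.submatrix_mul _ _ id id e Function.bijective_id] using this
  right_mul := by
    have := congrArg (fun B => B.submatrix e id) h.right_mul
    simpa [Matrix.submatrix_mul _ _ e id id Function.bijective_id] using this
  decay := by
    rw [Matrix.submatrix_mul_equiv]
    exact h.decay

/-- With `A ^ i = P + D` and `A' ^ i = P' + D'`, the error `A ^ i ⊗ A' ^ i - P ⊗ P'` is `D ⊗ D' + P
⊗ D' + D ⊗ P'`, and every term has a decaying factor. -/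
theorem kronecker {ι' κ' : Type*} [Fintype ι'] [DecidableEq ι'] [Fintype κ'] [DecidableEq κ']
    {A' : Matrix ι' ι' ℝ} {L' : Matrix ι' κ' ℝ} {R' : Matrix κ' ι' ℝ}
    (h : IsUnitSplitting A L R) (h' : IsUnitSplitting A' L' R') :
    IsUnitSplitting (A ⊗ₖ A') (L ⊗ₖ L') (R ⊗ₖ R') where
  right_mul_left := by
    rw [← Matrix.mul_kronecker_mul, h.right_mul_left, h'.right_mul_left, Matrix.one_kronecker_one]
  mul_left := by rw [← Matrix.mul_kronecker_mul, h.mul_left, h'.mul_left]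
  right_mul := by rw [← Matrix.mul_kronecker_mul, h.right_mul, h'.right_mul]
  decay := by
    have hpow : ∀ i : ℕ, (A ⊗ₖ A') ^ i = (A ^ i) ⊗ₖ (A' ^ i) := fun i => by
      induction i with
      | zero => simp
      | succ i ih => rw [pow_succ, ih, ← Matrix.mul_kronecker_mul, pow_succ, pow_succ]
    have := ((h.decay.kronecker h'.decay).add (h'.decay.const_kronecker (L * R))).add
      (h.decay.kronecker_const (L' * R'))
    refine (congrArg DecaysGeometrically (funext fun i => ?_)).mp this
    rw [hpow, ← Matrix.mul_kronecker_mul]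
    ext ⟨a, a'⟩ ⟨b, b'⟩
    simp only [Matrix.add_apply, Matrix.sub_apply, Matrix.kroneckerMap_apply]
    ring

end IsUnitSplitting

/-- If `(f - 1) y` is fixed by `f`, then `y` is a generalized eigenvector, hence an eigenvector by
semisimplicity, and `(f - 1) y = 0`. Rank-nullity upgrades disjointness to complementarity. -/
theorem isCompl_ker_range_of_semisimple {V : Type*} [AddCommGroup V] [Module ℝ V]
    [FiniteDimensional ℝ V] (f : Module.End ℝ V)
    (h : f.maxGenEigenspace 1 = f.eigenspace 1) :
    IsCompl (f.eigenspace 1) (LinearMap.range (f - 1)) := by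
  have hmem : ∀ x, x ∈ f.eigenspace 1 ↔ (f - 1) x = 0 := fun x => by
    rw [Module.End.mem_eigenspace_iff, LinearMap.sub_apply, sub_eq_zero]
    simp
  have hdisj : Disjoint (f.eigenspace 1) (LinearMap.range (f - 1)) := by
    rw [Submodule.disjoint_def]
    rintro _ hx ⟨y, rfl⟩
    have hy : y ∈ f.maxGenEigenspace 1 := by
      rw [Module.End.mem_maxGenEigenspace]
      refine ⟨2, ?_⟩
      rw [one_smul, pow_two, Module.End.mul_apply]
      exact (hmem _).1 hx
    rw [h] at hy
    exact (hmem y).1 hy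
  refine ⟨hdisj, codisjoint_iff.2 (Submodule.eq_top_of_disjoint _ _ ?_ hdisj)⟩
  have hker : f.eigenspace 1 = LinearMap.ker (f - 1) := by
    ext x
    rw [hmem, LinearMap.mem_ker]
  rw [hker, add_comm, LinearMap.finrank_range_add_finrank_ker]

/-- If the real matrix `P` fixes the real fixed vectors of the real matrix `A`, it fixes its complex
ones. -/
theorem Matrix.map_complex_mulVec_eq_self {d : ℕ} {A P : Matrix (Fin d) (Fin d) ℝ}
    (h : ∀ x : Fin d → ℝ, A *ᵥ x = x → P *ᵥ x = x) {v : Fin d → ℂ}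
    (hv : A.map (algebraMap ℝ ℂ) *ᵥ v = v) : P.map (algebraMap ℝ ℂ) *ᵥ v = v := by
  have hre : ∀ (B : Matrix (Fin d) (Fin d) ℝ) a,
      ((B.map (algebraMap ℝ ℂ) *ᵥ v) a).re = (B *ᵥ fun i => (v i).re) a := fun B a => by
    simp [Matrix.mulVec, dotProduct]
  have him : ∀ (B : Matrix (Fin d) (Fin d) ℝ) a,
      ((B.map (algebraMap ℝ ℂ) *ᵥ v) a).im = (B *ᵥ fun i => (v i).im) a := fun B a => by
    simp [Matrix.mulVec, dotProduct]
  have h1 := h _ (funext fun a => by rw [← hre, hv] : A *ᵥ (fun i => (v i).re) = _)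
  have h2 := h _ (funext fun a => by rw [← him, hv] : A *ᵥ (fun i => (v i).im) = _)
  ext a
  exact Complex.ext (by rw [hre, h1]) (by rw [him, h2])

/-- A real matrix whose eigenvalues other than a semisimple unit eigenvalue are stable admits a
splitting. -/
theorem exists_isUnitSplitting {d k : ℕ} {A : Matrix (Fin d) (Fin d) ℝ}
    (hA : HasSemisimpleUnitEigenvalue A k) (hs : OtherEigenvaluesStable A) :
    ∃ (L : Matrix (Fin d) (Fin k) ℝ) (R : Matrix (Fin k) (Fin d) ℝ), IsUnitSplitting A L R := by
  obtain ⟨hmult, hgeom⟩ := hA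
  set f : Module.End ℝ (Fin d → ℝ) := Matrix.toLin' A with hf
  have hgen : f.maxGenEigenspace 1 = f.eigenspace 1 := by
    refine (Submodule.eq_of_le_of_finrank_eq Module.End.eigenspace_le_maxGenEigenspace ?_).symm
    rw [hgeom, LinearMap.finrank_maxGenEigenspace_eq, hf, Matrix.charpoly_toLin', hmult]
  have hc := isCompl_ker_range_of_semisimple f hgen
  have hmem : ∀ x, x ∈ f.eigenspace 1 ↔ A *ᵥ x = x := fun x => by
    rw [Module.End.mem_eigenspace_iff, one_smul, hf, Matrix.toLin'_apply]
  let e : f.eigenspace 1 ≃ₗ[ℝ] (Fin k → ℝ) :=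
    LinearEquiv.ofFinrankEq _ _ (by rw [hgeom, Module.finrank_fin_fun])
  -- The projection onto the fixed space along the range of `f - 1`; in the coordinates `e`, `L` is
  -- the inclusion and `R` is this projection.
  let p := Submodule.projectionOnto _ _ hc
  set L := LinearMap.toMatrix' ((f.eigenspace 1).subtype ∘ₗ e.symm.toLinearMap) with hL
  set R := LinearMap.toMatrix' (e.toLinearMap ∘ₗ p) with hR
  have hLv : ∀ y, L *ᵥ y = (e.symm y : Fin d → ℝ) := fun y => by
    rw [hL, LinearMap.toMatrix'_mulVec]; rfl
  have hRv : ∀ x, R *ᵥ x = e (p x) := fun x => by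
    rw [hR, LinearMap.toMatrix'_mulVec]; rfl
  have hRL : R * L = 1 := Matrix.ext_of_mulVec_single fun i => by
    rw [← Matrix.mulVec_mulVec, hLv, hRv, Submodule.projectionOnto_apply_left, e.apply_symm_apply,
      Matrix.one_mulVec]
  have hAL : A * L = L := Matrix.ext_of_mulVec_single fun i => by
    rw [← Matrix.mulVec_mulVec, hLv, (hmem _).1 (e.symm _).2]
  have hRA : R * A = R := Matrix.ext_of_mulVec_single fun i => by
    rw [← Matrix.mulVec_mulVec, hRv, hRv, ← sub_eq_zero, ← map_sub, ← map_sub]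
    rw [LinearEquiv.map_eq_zero_iff, Submodule.projectionOnto_apply_eq_zero_iff]
    exact ⟨Pi.single i 1, by rw [LinearMap.sub_apply, hf, Matrix.toLin'_apply]; rfl⟩
  have hLR : ∀ x : Fin d → ℝ, A *ᵥ x = x → (L * R) *ᵥ x = x := fun x hx => by
    rw [← Matrix.mulVec_mulVec, hRv, hLv, e.symm_apply_apply]
    exact congrArg Subtype.val (Submodule.projectionOnto_apply_left hc ⟨x, (hmem x).2 hx⟩)
  have hPP : L * R * (L * R) = L * R := by
    rw [Matrix.mul_assoc, ← Matrix.mul_assoc R, hRL, Matrix.one_mul]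
  have hAP : A * (L * R) = L * R := by rw [← Matrix.mul_assoc, hAL]
  have hPA : L * R * A = L * R := by rw [Matrix.mul_assoc, hRA]
  -- Only positive exponents: at exponent zero the left side would be `1`, not `1 - L R`. Index zero
  -- is therefore treated apart by `of_tail`.
  have hpow : ∀ i : ℕ, (A - L * R) ^ (i + 1) = A ^ (i + 1) - L * R := fun i => by
    induction i with
    | zero => simp
    | succ i ih =>
      have hpP : A ^ (i + 1) * (L * R) = L * R := by
        clear ih
        induction i with
        | zero => rw [zero_add, pow_one, hAP]
        | succ i ih => rw [pow_succ, Matrix.mul_assoc, hAP, ih]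
      rw [pow_succ, ih, Matrix.sub_mul, Matrix.mul_sub, Matrix.mul_sub, hpP, hPA, hPP,
        ← pow_succ]
      abel
  -- Let `v` be an eigenvector of `A - L R` with `|z| ≥ 1`. As `L R (A - L R) = 0`, the projection
  -- kills `v`, so `A v = z v` and `z = 1` by stability. But `L R` fixes the fixed vectors of `A`,
  -- whence `v = 0`.
  have hspec : ∀ z ∈ spectrum ℂ ((A - L * R).map (algebraMap ℝ ℂ)), ‖z‖ < 1 := by
    intro z hz
    by_contra! hz1
    have hz0 : z ≠ 0 := norm_pos_iff.1 (one_pos.trans_le hz1)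
    have hPN : L * R * (A - L * R) = 0 := by rw [Matrix.mul_sub, hPA, hPP, sub_self]
    rw [← Matrix.spectrum_toLin', ← Module.End.hasEigenvalue_iff_mem_spectrum] at hz
    obtain ⟨v, hv⟩ := hz.exists_hasEigenvector
    have hNv := hv.apply_eq_smul
    rw [Matrix.toLin'_apply] at hNv
    have hPv : (L * R).map (algebraMap ℝ ℂ) *ᵥ v = 0 := by
      have h0 := congrArg ((L * R).map (algebraMap ℝ ℂ) *ᵥ ·) hNv
      simp only [Matrix.mulVec_mulVec, Matrix.mulVec_smul] at h0
      rw [← Matrix.map_mul, hPN, Matrix.map_zero _ (map_zero _), Matrix.zero_mulVec] at h0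
      exact (smul_eq_zero.1 h0.symm).resolve_left hz0
    have hAv : A.map (algebraMap ℝ ℂ) *ᵥ v = z • v := by
      rw [← hNv, Matrix.map_sub _ (map_sub _), Matrix.sub_mulVec, hPv, sub_zero]
    have hzA : z ∈ spectrum ℂ (A.map (algebraMap ℝ ℂ)) := by
      rw [← Matrix.spectrum_toLin', ← Module.End.hasEigenvalue_iff_mem_spectrum]
      exact Module.End.hasEigenvalue_of_hasEigenvector
        ⟨Module.End.mem_eigenspace_iff.2 (by rw [Matrix.toLin'_apply, hAv]), hv.2⟩
    have hz : z = 1 := by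
      by_contra hne
      exact (hs z hzA hne).not_ge hz1
    rw [hz, one_smul] at hAv
    refine hv.2 ?_
    rw [← Matrix.map_complex_mulVec_eq_self hLR hAv, hPv]
  refine ⟨L, R, hRL, hAL, hRA, ?_⟩
  set B : Matrix (Fin d) (Fin d) ℝ := A ^ 0 - L * R with hB
  refine DecaysGeometrically.of_tail (M₀ := ∑ p : Fin d × Fin d, |B p.1 p.2|) ?_ ?_
  · obtain ⟨M, ρ, hM, h0, h1, h⟩ :=
      (DecaysGeometrically.pow_of_spectrum_lt_one _ hspec).exists_pos
    refine ⟨M, ρ, h0, h1, fun i a b => ?_⟩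
    dsimp only
    rw [← hpow]
    refine (h (i + 1) a b).trans ?_
    gcongr M * ?_
    exact pow_le_pow_of_le_one h0 h1.le i.le_succ
  · intro a b
    exact Finset.single_le_sum (f := fun p : Fin d × Fin d => |B p.1 p.2|)
      (fun _ _ => abs_nonneg _) (Finset.mem_univ (a, b))

/-! ### Linear filters of white noise -/

section Filters

variable {Ω : Type*} [MeasurableSpace Ω] {μ : Measure Ω} {ι κ : Type*} [Fintype ι] [Fintype κ]

theorem MeasureTheory.MemLp.matrix_mulVec {f : Ω → ι → ℝ} (hf : MemLp f 2 μ)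
    (B : Matrix κ ι ℝ) : MemLp (fun ω => B *ᵥ f ω) 2 μ :=
  ContinuousLinearMap.comp_memLp' (LinearMap.toContinuousLinearMap B.mulVecLin) hf

theorem MeasureTheory.MemLp.coord {f : Ω → ι → ℝ} (hf : MemLp f 2 μ) (a : ι) :
    MemLp (fun ω => f ω a) 2 μ :=
  memLp_pi_iff.1 hf a

theorem Matrix.norm_mulVec_le_of_abs_le (B : Matrix κ ι ℝ) {c : ℝ} (hc : 0 ≤ c)
    (hB : ∀ a b, |B a b| ≤ c) (v : ι → ℝ) : ‖B *ᵥ v‖ ≤ Fintype.card ι * c * ‖v‖ := by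
  refine (pi_norm_le_iff_of_nonneg (by positivity)).2 fun a => ?_
  calc ‖(B *ᵥ v) a‖ ≤ ∑ b, ‖B a b * v b‖ := norm_sum_le _ _
    _ ≤ ∑ _b : ι, c * ‖v‖ := by
        refine Finset.sum_le_sum fun b _ => ?_
        rw [norm_mul]
        exact mul_le_mul (hB a b) (norm_le_pi_norm v b) (norm_nonneg _) hc
    _ = _ := by rw [Finset.sum_const, Finset.card_univ, nsmul_eq_mul]; ring

theorem eLpNorm_mulVec_le (B : Matrix κ ι ℝ) {c : ℝ} (hc : 0 ≤ c) (hB : ∀ a b, |B a b| ≤ c)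
    (f : Ω → ι → ℝ) : eLpNorm (fun ω => B *ᵥ f ω) 2 μ ≤
      ENNReal.ofReal (Fintype.card ι * c) * eLpNorm f 2 μ :=
  eLpNorm_le_mul_eLpNorm_of_ae_le_mul
    (Eventually.of_forall fun ω => B.norm_mulVec_le_of_abs_le hc hB (f ω)) 2

theorem Matrix.exists_abs_le (B : Matrix κ ι ℝ) : ∃ c : ℝ, 0 ≤ c ∧ ∀ a b, |B a b| ≤ c :=
  ⟨∑ p : κ × ι, |B p.1 p.2|, Finset.sum_nonneg fun _ _ => abs_nonneg _, fun a b =>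
    Finset.single_le_sum (f := fun p : κ × ι => |B p.1 p.2|) (fun _ _ => abs_nonneg _)
      (Finset.mem_univ (a, b))⟩

theorem tendsto_eLpNorm_mulVec {f : ℕ → Ω → ι → ℝ} (B : Matrix κ ι ℝ)
    (hf : Tendsto (fun N => eLpNorm (f N) 2 μ) atTop (𝓝 0)) :
    Tendsto (fun N => eLpNorm (fun ω => B *ᵥ f N ω) 2 μ) atTop (𝓝 0) := by
  obtain ⟨c, hc, hB⟩ := B.exists_abs_le
  refine tendsto_of_tendsto_of_tendsto_of_le_of_le tendsto_const_nhds ?_ (fun _ => zero_le)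
    fun N => eLpNorm_mulVec_le B hc hB (f N)
  simpa only [mul_zero] using ENNReal.Tendsto.const_mul (a := ENNReal.ofReal (Fintype.card ι * c))
    hf (Or.inr ENNReal.ofReal_ne_top)

theorem tendsto_eLpNorm_mulVec_of_decays {D : ℕ → Matrix κ ι ℝ} (hD : DecaysGeometrically D)
    {f : Ω → ι → ℝ} (hf : MemLp f 2 μ) :
    Tendsto (fun N => eLpNorm (fun ω => D N *ᵥ f ω) 2 μ) atTop (𝓝 0) := by
  obtain ⟨M, ρ, hM, h0, h1, h⟩ := hD.exists_pos
  refine tendsto_of_tendsto_of_tendsto_of_le_of_le tendsto_const_nhds ?_ (fun _ => zero_le)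
    fun N => eLpNorm_mulVec_le (D N) (by positivity) (h N) f
  have h2 : Tendsto (fun N : ℕ => (Fintype.card ι : ℝ) * (M * ρ ^ N)) atTop (𝓝 0) := by
    simpa using ((tendsto_pow_atTop_nhds_zero_of_lt_one h0 h1).const_mul M).const_mul
      (Fintype.card ι : ℝ)
  have h3 := ENNReal.Tendsto.mul_const (ENNReal.tendsto_ofReal h2) (Or.inr hf.eLpNorm_ne_top)
  simpa using h3

theorem tendsto_eLpNorm_coord {f : ℕ → Ω → ι → ℝ}
    (hf : Tendsto (fun N => eLpNorm (f N) 2 μ) atTop (𝓝 0)) (a : ι) :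
    Tendsto (fun N => eLpNorm (fun ω => f N ω a) 2 μ) atTop (𝓝 0) :=
  tendsto_of_tendsto_of_tendsto_of_le_of_le tendsto_const_nhds hf (fun _ => zero_le)
    fun N => eLpNorm_mono fun ω => norm_le_pi_norm (f N ω) a

theorem eLpNorm_le_sum_coord {f : Ω → ι → ℝ} (hf : MemLp f 2 μ) :
    eLpNorm f 2 μ ≤ ∑ a, eLpNorm (fun ω => f ω a) 2 μ := by
  calc eLpNorm f 2 μ ≤ eLpNorm (∑ a, fun ω => ‖f ω a‖) 2 μ := by
        refine eLpNorm_mono fun ω => ?_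
        have h0 : 0 ≤ ∑ a, ‖f ω a‖ := Finset.sum_nonneg fun _ _ => norm_nonneg _
        rw [Finset.sum_apply, Real.norm_of_nonneg h0, pi_norm_le_iff_of_nonneg h0]
        exact fun a => Finset.single_le_sum (f := fun a => ‖f ω a‖) (fun _ _ => norm_nonneg _)
          (Finset.mem_univ a)
    _ ≤ ∑ a, eLpNorm (fun ω => ‖f ω a‖) 2 μ :=
        eLpNorm_sum_le (fun a _ => (hf.coord a).1.norm) (by norm_num)
    _ = _ := by simp only [eLpNorm_norm]

/-- The product of two sequences that converge in mean square converges in mean. -/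
theorem tendsto_integral_mul {f g : ℕ → Ω → ℝ} {f' g' : Ω → ℝ} (hf : ∀ N, MemLp (f N) 2 μ)
    (hg : ∀ N, MemLp (g N) 2 μ) (hf' : MemLp f' 2 μ) (hg' : MemLp g' 2 μ)
    (hft : Tendsto (fun N => eLpNorm (f N - f') 2 μ) atTop (𝓝 0))
    (hgt : Tendsto (fun N => eLpNorm (g N - g') 2 μ) atTop (𝓝 0)) :
    Tendsto (fun N => ∫ ω, f N ω * g N ω ∂μ) atTop (𝓝 (∫ ω, f' ω * g' ω ∂μ)) := by
  -- The integral of a product is an inner product in `L²`, which is continuous.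
  have key : ∀ {u v : Ω → ℝ} (hu : MemLp u 2 μ) (hv : MemLp v 2 μ),
      inner ℝ (hv.toLp v) (hu.toLp u) = ∫ ω, u ω * v ω ∂μ := fun {u v} hu hv => by
    rw [L2.inner_def]
    refine integral_congr_ae ?_
    filter_upwards [hu.coeFn_toLp, hv.coeFn_toLp] with ω h1 h2
    rw [h1, h2]
    rfl
  have h1 := (Lp.tendsto_Lp_iff_tendsto_eLpNorm'' f hf f' hf').2 hft
  have h2 := (Lp.tendsto_Lp_iff_tendsto_eLpNorm'' g hg g' hg').2 hgt
  have h3 := h2.inner (𝕜 := ℝ) h1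
  simpa only [key] using h3

/-- A geometrically weighted sum of random vectors bounded in mean square converges in mean
square. -/
theorem exists_tendsto_eLpNorm_sum {D : ℕ → Matrix κ ι ℝ} (hD : DecaysGeometrically D)
    {f : ℕ → Ω → ι → ℝ} (hf : ∀ i, MemLp (f i) 2 μ) {K : NNReal}
    (hK : ∀ i, eLpNorm (f i) 2 μ ≤ K) :
    ∃ W : Ω → κ → ℝ, MemLp W 2 μ ∧ Tendsto (fun N : ℕ =>
      eLpNorm (fun ω => W ω - ∑ i ∈ Finset.range N, D i *ᵥ f i ω) 2 μ) atTop (𝓝 0) := by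
  obtain ⟨M, ρ, hM, h0, h1, h⟩ := hD.exists_pos
  have hg : ∀ i, MemLp (fun ω => D i *ᵥ f i ω) 2 μ := fun i => (hf i).matrix_mulVec (D i)
  let g : ℕ → Lp (κ → ℝ) 2 μ := fun i => (hg i).toLp _
  -- Geometric norms make the series absolutely convergent in the complete space `L²`.
  have hnorm : ∀ i, ‖g i‖ ≤ (Fintype.card ι * M * K) * ρ ^ i := fun i => by
    rw [Lp.norm_toLp]
    refine ENNReal.toReal_le_of_le_ofReal (by positivity) ?_
    calc _ ≤ ENNReal.ofReal (Fintype.card ι * (M * ρ ^ i)) * eLpNorm (f i) 2 μ :=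
          eLpNorm_mulVec_le (D i) (by positivity) (h i) (f i)
      _ ≤ ENNReal.ofReal (Fintype.card ι * (M * ρ ^ i)) * K := by gcongr; exact hK i
      _ = _ := by
          rw [← ENNReal.ofReal_coe_nnreal, ← ENNReal.ofReal_mul (by positivity)]
          congr 1
          ring
  have hsum : Summable g :=
    Summable.of_norm_bounded ((summable_geometric_of_lt_one h0 h1).mul_left _) hnorm
  refine ⟨(∑' i, g i : Lp (κ → ℝ) 2 μ), Lp.memLp _, ?_⟩
  have ht := (Lp.tendsto_Lp_iff_tendsto_eLpNorm' _ _).1 hsum.hasSum.tendsto_sum_nat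
  refine ht.congr fun N => ?_
  rw [eLpNorm_sub_comm]
  refine eLpNorm_congr_ae ?_
  have hs : ∀ᵐ ω ∂μ, (∑ i ∈ Finset.range N, g i : Lp (κ → ℝ) 2 μ) ω =
      ∑ i ∈ Finset.range N, D i *ᵥ f i ω := by
    filter_upwards [Lp.coeFn_finsetSum (Finset.range N) g,
      ae_all_iff.2 fun i => (hg i).coeFn_toLp] with ω h1 h2
    rw [h1, Finset.sum_apply]
    exact Finset.sum_congr rfl fun i _ => h2 i
  filter_upwards [hs] with ω hω
  rw [Pi.sub_apply, hω]

variable [IsProbabilityMeasure μ]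

theorem tendsto_integral_of_eLpNorm {f : ℕ → Ω → ℝ} {f' : Ω → ℝ} (hf : ∀ N, MemLp (f N) 2 μ)
    (hf' : MemLp f' 2 μ) (hft : Tendsto (fun N => eLpNorm (f N - f') 2 μ) atTop (𝓝 0)) :
    Tendsto (fun N => ∫ ω, f N ω ∂μ) atTop (𝓝 (∫ ω, f' ω ∂μ)) := by
  simpa using tendsto_integral_mul hf (fun _ => memLp_const (1 : ℝ)) hf' (memLp_const (1 : ℝ)) hft
    (by simp)

theorem tendsto_covariance {f g : ℕ → Ω → ℝ} {f' g' : Ω → ℝ} (hf : ∀ N, MemLp (f N) 2 μ)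
    (hg : ∀ N, MemLp (g N) 2 μ) (hf' : MemLp f' 2 μ) (hg' : MemLp g' 2 μ)
    (hft : Tendsto (fun N => eLpNorm (f N - f') 2 μ) atTop (𝓝 0))
    (hgt : Tendsto (fun N => eLpNorm (g N - g') 2 μ) atTop (𝓝 0)) :
    Tendsto (fun N => covariance (f N) (g N) μ) atTop (𝓝 (covariance f' g' μ)) := by
  simp only [covariance_eq_sub (hf _) (hg _)]
  rw [covariance_eq_sub hf' hg']
  exact (tendsto_integral_mul hf hg hf' hg' hft hgt).sub
    ((tendsto_integral_of_eLpNorm hf hf' hft).mul (tendsto_integral_of_eLpNorm hg hg' hgt))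

theorem eLpNorm_two_eq_sqrt {f : Ω → ℝ} (hf : MemLp f 2 μ) :
    eLpNorm f 2 μ = ENNReal.ofReal √(covariance f f μ + (∫ ω, f ω ∂μ) ^ 2) := by
  rw [hf.eLpNorm_eq_integral_rpow_norm two_ne_zero ENNReal.ofNat_ne_top,
    covariance_eq_sub hf hf, Real.sqrt_eq_rpow]
  congr 2
  · simp only [ENNReal.toReal_ofNat, Real.rpow_ofNat, Real.norm_eq_abs, sq_abs, Pi.mul_apply]
    rw [← pow_two (∫ ω, f ω ∂μ), sub_add_cancel]
    simp only [pow_two]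
  · norm_num

theorem covariance_self_le_of_eLpNorm_le {f : Ω → ℝ} (hf : MemLp f 2 μ) {K : NNReal}
    (h : eLpNorm f 2 μ ≤ K) : covariance f f μ ≤ (K : ℝ) ^ 2 := by
  rw [eLpNorm_two_eq_sqrt hf, ← ENNReal.ofReal_coe_nnreal,
    ENNReal.ofReal_le_ofReal_iff K.coe_nonneg] at h
  have h2 := Real.sqrt_le_iff.1 h
  nlinarith [h2.2, sq_nonneg (∫ ω, f ω ∂μ)]

/-- Mean and variance determine the second moment of each coordinate; the uniform bounds for white
noise and for stationary processes both come from here. -/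
theorem exists_eLpNorm_le_of_const {T : Type*} {f : T → Ω → ι → ℝ} (hf : ∀ t, MemLp (f t) 2 μ)
    {c v : ι → ℝ} (hc : ∀ t a, ∫ ω, f t ω a ∂μ = c a)
    (hv : ∀ t a, covariance (fun ω => f t ω a) (fun ω => f t ω a) μ = v a) :
    ∃ K : NNReal, ∀ t, eLpNorm (f t) 2 μ ≤ K := by
  refine ⟨∑ a, (√(v a + c a ^ 2)).toNNReal, fun t => (eLpNorm_le_sum_coord (hf t)).trans ?_⟩
  rw [ENNReal.ofNNReal_finsetSum]
  refine Finset.sum_le_sum fun a _ => ?_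
  rw [eLpNorm_two_eq_sqrt ((hf t).coord a), hc, hv]
  rfl

theorem IsWhiteNoise.exists_eLpNorm_le {T : Type*} {e : T → Ω → ι → ℝ} (he : IsWhiteNoise μ e) :
    ∃ K : NNReal, ∀ t, eLpNorm (e t) 2 μ ≤ K := by
  obtain ⟨h1, h2, ⟨S, -, h3⟩, -⟩ := he
  exact exists_eLpNorm_le_of_const h1 h2 (v := fun a => S a a) fun t a => h3 t a a

theorem IsWeaklyStationary.exists_eLpNorm_le {y : ℕ → Ω → ι → ℝ} (hy : IsWeaklyStationary μ y) :
    ∃ K : NNReal, ∀ t, eLpNorm (y t) 2 μ ≤ K := by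
  obtain ⟨h1, h2, h3⟩ := hy
  exact exists_eLpNorm_le_of_const h1 h2 fun t a => by simpa using h3 t 0 a a

end Filters

/-! ### Second moments of filtered white noise -/

section WhiteNoise

variable {Ω : Type*} [MeasurableSpace Ω] {μ : Measure Ω} {ι κ : Type*} [Fintype ι]

theorem IsWhiteNoise.covariance_shift {e : ℤ → Ω → ι → ℝ} (he : IsWhiteNoise μ e) (s s' r : ℤ) (k l : ι) :
    covariance (fun ω => e (s + r) ω k) (fun ω => e (s' + r) ω l) μ =
      covariance (fun ω => e s ω k) (fun ω => e s' ω l) μ := by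
  obtain ⟨-, -, ⟨S, -, hS⟩, h0⟩ := he
  rcases eq_or_ne s s' with rfl | hne
  · rw [hS, hS]
  · rw [h0 _ _ hne, h0 _ _ (by omega)]

variable [IsProbabilityMeasure μ]

theorem covariance_mulVec_mulVec {κ' : Type*} {f g : Ω → ι → ℝ} (hf : MemLp f 2 μ)
    (hg : MemLp g 2 μ) (B : Matrix κ ι ℝ) (B' : Matrix κ' ι ℝ) (a : κ) (b : κ') :
    covariance (fun ω => (B *ᵥ f ω) a) (fun ω => (B' *ᵥ g ω) b) μ =
      ∑ k, ∑ l, B a k * (B' b l * covariance (fun ω => f ω k) (fun ω => g ω l) μ) := by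
  simp only [Matrix.mulVec, dotProduct]
  rw [covariance_fun_sum_fun_sum (fun k => (hf.coord k).const_mul _)
    (fun l => (hg.coord l).const_mul _)]
  simp only [covariance_const_mul_left, covariance_const_mul_right, mul_left_comm]

theorem integral_mulVec {f : Ω → ι → ℝ} (hf : MemLp f 2 μ) (B : Matrix κ ι ℝ) (a : κ) :
    ∫ ω, (B *ᵥ f ω) a ∂μ = ∑ k, B a k * ∫ ω, f ω k ∂μ := by
  simp only [Matrix.mulVec, dotProduct]
  rw [integral_finsetSum _ fun k _ =>
    ((hf.coord k).integrable one_le_two).const_mul (B a k)]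
  simp only [integral_const_mul]

namespace IsWhiteNoise

theorem integral_mulVec_eq_zero {T : Type*} {e : T → Ω → ι → ℝ} (he : IsWhiteNoise μ e)
    (B : Matrix κ ι ℝ) (t : T) (a : κ) : ∫ ω, (B *ᵥ e t ω) a ∂μ = 0 := by
  rw [integral_mulVec (he.1 t)]
  simp [he.2.1]

variable [Fintype κ]

/-- A linear image of full row rank of a white noise, along an injective time change, is a white
noise. -/
theorem mulVec_comp {T T' : Type*} {e : T → Ω → ι → ℝ} (he : IsWhiteNoise μ e) {φ : T' → T}
    (hφ : Function.Injective φ) {R : Matrix κ ι ℝ} (hR : Function.Injective R.vecMul) :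
    IsWhiteNoise μ fun t ω => R *ᵥ e (φ t) ω := by
  refine ⟨fun t => (he.1 _).matrix_mulVec R, fun t a => he.integral_mulVec_eq_zero R _ a, ?_, ?_⟩
  · obtain ⟨S, hS, hcov⟩ := he.2.2.1
    refine ⟨R * S * Rᴴ, hS.mul_mul_conjTranspose_same hR, fun t a b => ?_⟩
    rw [covariance_mulVec_mulVec (he.1 _) (he.1 _), Matrix.mul_apply, Finset.sum_comm]
    refine Finset.sum_congr rfl fun l _ => ?_
    rw [Matrix.mul_apply, Finset.sum_mul]
    refine Finset.sum_congr rfl fun k _ => ?_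
    rw [hcov, Matrix.conjTranspose_apply, star_trivial]
    ring
  · intro s t hst a b
    rw [covariance_mulVec_mulVec (he.1 _) (he.1 _)]
    simp [he.2.2.2 _ _ (hφ.ne hst)]

/-- A mean square limit of moving averages of a white noise is weakly stationary. -/
theorem isWeaklyStationary_of_tendsto {e : ℤ → Ω → ι → ℝ} (he : IsWhiteNoise μ e)
    {D : ℕ → Matrix κ ι ℝ} {y : ℕ → Ω → κ → ℝ} (hy : ∀ t, MemLp (y t) 2 μ)
    (hlim : ∀ t : ℕ, Tendsto (fun N : ℕ => eLpNorm
      (fun ω => y t ω - ∑ i ∈ Finset.range N, D i *ᵥ e ((t : ℤ) - (i : ℤ)) ω) 2 μ)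
      atTop (𝓝 0)) : IsWeaklyStationary μ y := by
  let p : ℕ → ℕ → Ω → κ → ℝ := fun t N ω =>
    ∑ i ∈ Finset.range N, D i *ᵥ e ((t : ℤ) - (i : ℤ)) ω
  have hterm : ∀ (t i : ℕ), MemLp (fun ω => D i *ᵥ e ((t : ℤ) - (i : ℤ)) ω) 2 μ := fun t i =>
    (he.1 _).matrix_mulVec _
  have hp : ∀ t N, MemLp (p t N) 2 μ := fun t N => memLp_finsetSum _ fun i _ => hterm t i
  have hpc : ∀ t N a, (fun ω => p t N ω a) =
      fun ω => ∑ i ∈ Finset.range N, (D i *ᵥ e ((t : ℤ) - (i : ℤ)) ω) a := fun t N a =>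
    funext fun ω => Finset.sum_apply _ _ _
  have hpy : ∀ t a, Tendsto (fun N => eLpNorm ((fun ω => p t N ω a) - fun ω => y t ω a) 2 μ)
      atTop (𝓝 0) := fun t a => by
    refine (tendsto_eLpNorm_coord (hlim t) a).congr fun N => ?_
    rw [eLpNorm_sub_comm]
    rfl
  have hmean : ∀ t a, ∫ ω, y t ω a ∂μ = 0 := fun t a => by
    have h1 := tendsto_integral_of_eLpNorm (fun N => (hp t N).coord a) ((hy t).coord a) (hpy t a)
    refine tendsto_nhds_unique h1 (tendsto_const_nhds.congr fun N => ?_)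
    rw [hpc, integral_finsetSum _ fun i _ => ((hterm t i).coord a).integrable one_le_two]
    exact (Finset.sum_eq_zero fun i _ => he.integral_mulVec_eq_zero _ _ a).symm
  refine ⟨hy, fun t a => by rw [hmean, hmean], fun t h a b => ?_⟩
  have hlim2 : ∀ t t', Tendsto
      (fun N => covariance (fun ω => p t N ω a) (fun ω => p t' N ω b) μ) atTop
      (𝓝 (covariance (fun ω => y t ω a) (fun ω => y t' ω b) μ)) := fun t t' =>
    tendsto_covariance (fun N => (hp t N).coord a) (fun N => (hp t' N).coord b)
      ((hy t).coord a) ((hy t').coord b) (hpy t a) (hpy t' b)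
  -- Covariances pass to the limit, so it suffices to compare truncations of equal length, where a
  -- common time shift changes nothing.
  refine tendsto_nhds_unique (hlim2 t (t + h)) ((hlim2 0 h).congr fun N => ?_)
  rw [hpc, hpc, hpc, hpc,
    covariance_fun_sum_fun_sum' (fun i _ => (hterm 0 i).coord a) (fun i _ => (hterm h i).coord b),
    covariance_fun_sum_fun_sum' (fun i _ => (hterm t i).coord a)
      (fun i _ => (hterm (t + h) i).coord b)]
  refine Finset.sum_congr rfl fun i _ => Finset.sum_congr rfl fun j _ => ?_
  rw [covariance_mulVec_mulVec (he.1 _) (he.1 _), covariance_mulVec_mulVec (he.1 _) (he.1 _)]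
  refine Finset.sum_congr rfl fun k _ => Finset.sum_congr rfl fun l _ => ?_
  rw [← he.covariance_shift _ _ (t : ℤ)]
  push_cast
  ring_nf

/-- A linear functional of a white noise has bounded partial sums only if it vanishes. -/
theorem eq_zero_of_bounded_sum {e : ℕ → Ω → ι → ℝ} (he : IsWhiteNoise μ e) {c : ι → ℝ}
    {K : NNReal}
    (hK : ∀ t, eLpNorm (fun ω => ∑ s ∈ Finset.range t, c ⬝ᵥ e s ω) 2 μ ≤ K) : c = 0 := by
  by_contra hc
  obtain ⟨S, hS, hcov⟩ := he.2.2.1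
  set B : Matrix Unit ι ℝ := Matrix.of fun _ => c with hB
  have hBe : ∀ s ω, c ⬝ᵥ e s ω = (B *ᵥ e s ω) () := fun s ω => rfl
  have hmem : ∀ s, MemLp (fun ω => c ⬝ᵥ e s ω) 2 μ := fun s =>
    ((he.1 s).matrix_mulVec B).coord ()
  set v : ℝ := ∑ k, ∑ l, c k * (c l * S k l) with hv
  have hvpos : 0 < v := by
    have := hS.dotProduct_mulVec_pos hc
    refine this.trans_eq ?_
    simp only [hv, dotProduct, Matrix.mulVec, star_trivial, Finset.mul_sum]
    exact Finset.sum_congr rfl fun k _ => Finset.sum_congr rfl fun l _ => by ring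
  -- Uncorrelated terms of common variance `v = c' S c` add up, so the bound `K ^ 2` fails once `t >
  -- K ^ 2 / v`.
  have hvar : ∀ t : ℕ, covariance (fun ω => ∑ s ∈ Finset.range t, c ⬝ᵥ e s ω)
      (fun ω => ∑ s ∈ Finset.range t, c ⬝ᵥ e s ω) μ = t * v := fun t => by
    rw [covariance_fun_sum_fun_sum' (fun s _ => hmem s) (fun s _ => hmem s)]
    have : ∀ s s', covariance (fun ω => c ⬝ᵥ e s ω) (fun ω => c ⬝ᵥ e s' ω) μ =
        if s = s' then v else 0 := fun s s' => by
      simp only [hBe]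
      rw [covariance_mulVec_mulVec (he.1 _) (he.1 _)]
      split_ifs with h
      · subst h
        simp only [hcov]
        rfl
      · simp [he.2.2.2 _ _ h]
    simp only [this]
    rw [Finset.sum_congr rfl fun s hs => Finset.sum_ite_eq _ s _]
    rw [Finset.sum_congr rfl fun s hs => if_pos hs]
    simp
  obtain ⟨t, ht⟩ := exists_nat_gt ((K : ℝ) ^ 2 / v)
  have h1 := covariance_self_le_of_eLpNorm_le (memLp_finsetSum _ fun s _ => hmem s) (hK t)
  rw [hvar] at h1
  rw [div_lt_iff₀ hvpos] at ht
  exact absurd h1 ht.not_ge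

end IsWhiteNoise

end WhiteNoise

/-! ### Vector autoregressive processes with a semisimple unit eigenvalue -/

section VAR

variable {Ω : Type*} [MeasurableSpace Ω] {μ : Measure Ω} {ι κ : Type*} [Fintype ι]

/-- `x` is a vector autoregressive process of order one: `x_t = A x_{t-1} + e_t` for `t ≥ 1`, started
from a square integrable random vector. -/
def IsVAR1 (μ : Measure Ω) (A : Matrix ι ι ℝ) (e : ℤ → Ω → ι → ℝ) (x : ℕ → Ω → ι → ℝ) : Prop :=
  MemLp (x 0) 2 μ ∧ ∀ t : ℕ, ∀ᵐ ω ∂μ, x (t + 1) ω = A *ᵥ x t ω + e (t + 1) ω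

variable {A : Matrix ι ι ℝ} {e : ℤ → Ω → ι → ℝ} {x y : ℕ → Ω → ι → ℝ}

theorem IsVAR1.memLp (hx : IsVAR1 μ A e x) (he : ∀ t, MemLp (e t) 2 μ) (t : ℕ) :
    MemLp (x t) 2 μ := by
  induction t with
  | zero => exact hx.1
  | succ t ih =>
    exact (memLp_congr_ae (hx.2 t)).2 ((ih.matrix_mulVec A).add (he _))

/-- The solution of `x_t = A x_{t-1} + e_t` with initial value `ξ`. -/
def varSolution (A : Matrix ι ι ℝ) (e : ℤ → Ω → ι → ℝ) (ξ : Ω → ι → ℝ) : ℕ → Ω → ι → ℝ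
  | 0 => ξ
  | t + 1 => fun ω => A *ᵥ varSolution A e ξ t ω + e (t + 1) ω

theorem isVAR1_varSolution {ξ : Ω → ι → ℝ} (hξ : MemLp ξ 2 μ) :
    IsVAR1 μ A e (varSolution A e ξ) :=
  ⟨hξ, fun _ => Eventually.of_forall fun _ => rfl⟩

variable [DecidableEq ι] [Fintype κ] {L : Matrix ι κ ℝ} {R : Matrix κ ι ℝ}

theorem IsVAR1.sub_ae_eq (hx : IsVAR1 μ A e x) (hy : IsVAR1 μ A e y) (t : ℕ) :
    ∀ᵐ ω ∂μ, x t ω - y t ω = A ^ t *ᵥ (x 0 ω - y 0 ω) := by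
  induction t with
  | zero => simp
  | succ t ih =>
    filter_upwards [ih, hx.2 t, hy.2 t] with ω h1 h2 h3
    rw [h2, h3, add_sub_add_right_eq_sub, ← Matrix.mulVec_sub, h1, Matrix.mulVec_mulVec, pow_succ']

/-- A solution of `x_t = A x_{t-1} + e_t` whose component along the stable part of `A` is the
stationary moving average of the innovations. -/
structure IsEquilibriumSolution (μ : Measure Ω) (A : Matrix ι ι ℝ) (L : Matrix ι κ ℝ)
    (R : Matrix κ ι ℝ) (e : ℤ → Ω → ι → ℝ) (x : ℕ → Ω → ι → ℝ) : Prop where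
  memLp : ∀ t, MemLp (x t) 2 μ
  recursion : ∀ (t : ℕ) ω, x (t + 1) ω = A *ᵥ x t ω + e (t + 1) ω
  tendsto : ∀ t : ℕ, Tendsto (fun N : ℕ => eLpNorm (fun ω => (1 - L * R) *ᵥ x t ω -
    ∑ i ∈ Finset.range N, (A ^ i * (1 - L * R)) *ᵥ e ((t : ℤ) - (i : ℤ)) ω) 2 μ) atTop (𝓝 0)

namespace IsEquilibriumSolution

theorem isVAR1 (hx : IsEquilibriumSolution μ A L R e x) : IsVAR1 μ A e x :=
  ⟨hx.memLp 0, fun t => Eventually.of_forall (hx.recursion t)⟩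

/-- The condition `B L = 0` gives `B (1 - L R) = B`, so `B x` sees only the stable component. -/
theorem tendsto_mulVec {γ : Type*} [Fintype γ] (hx : IsEquilibriumSolution μ A L R e x)
    {B : Matrix γ ι ℝ} (hB : B * L = 0) (t : ℕ) :
    Tendsto (fun N : ℕ => eLpNorm (fun ω => B *ᵥ x t ω - ∑ i ∈ Finset.range N,
      (B * (A ^ i * (1 - L * R))) *ᵥ e ((t : ℤ) - (i : ℤ)) ω) 2 μ) atTop (𝓝 0) := by
  refine (tendsto_eLpNorm_mulVec B (hx.tendsto t)).congr fun N => ?_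
  congr 1
  funext ω
  rw [Matrix.mulVec_sub, Matrix.mulVec_mulVec, Matrix.mul_sub, Matrix.mul_one, ← Matrix.mul_assoc,
    hB, Matrix.zero_mul, sub_zero, Matrix.mulVec_sum]
  simp only [Matrix.mulVec_mulVec]

theorem isWeaklyStationary_mulVec [IsProbabilityMeasure μ] {γ : Type*} [Fintype γ]
    (hx : IsEquilibriumSolution μ A L R e x) (he : IsWhiteNoise μ e) {B : Matrix γ ι ℝ}
    (hB : B * L = 0) : IsWeaklyStationary μ fun t ω => B *ᵥ x t ω :=
  he.isWeaklyStationary_of_tendsto (fun t => (hx.memLp t).matrix_mulVec B) (hx.tendsto_mulVec hB)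

end IsEquilibriumSolution

variable [DecidableEq κ]

theorem IsUnitSplitting.compl_mul_comm (h : IsUnitSplitting A L R) :
    (1 - L * R) * A = A * (1 - L * R) := by
  have h2 := h.compl_mul_pow 1
  have h3 := h.pow_mul_compl 1
  rw [pow_one] at h2 h3
  rw [h2, h3]

/-- Applying `A` raises every power in the moving average by one, and the new innovation supplies
the term `i = 0`; hence the shift of the truncation length. -/
theorem IsUnitSplitting.tendsto_step (h : IsUnitSplitting A L R) {u v : Ω → ι → ℝ} {t : ℕ}
    (huv : ∀ ω, v ω = A *ᵥ u ω + e (t + 1) ω)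
    (hu : Tendsto (fun N : ℕ => eLpNorm (fun ω => (1 - L * R) *ᵥ u ω -
      ∑ i ∈ Finset.range N, (A ^ i * (1 - L * R)) *ᵥ e ((t : ℤ) - (i : ℤ)) ω) 2 μ) atTop (𝓝 0)) :
    Tendsto (fun N : ℕ => eLpNorm (fun ω => (1 - L * R) *ᵥ v ω - ∑ i ∈ Finset.range N,
      (A ^ i * (1 - L * R)) *ᵥ e (((t + 1 : ℕ) : ℤ) - (i : ℤ)) ω) 2 μ) atTop (𝓝 0) := by
  rw [← tendsto_add_atTop_iff_nat 1]
  refine (tendsto_eLpNorm_mulVec A hu).congr fun N => ?_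
  refine congrArg (eLpNorm · 2 μ) (funext fun ω => ?_)
  have h1 : ∀ i : ℕ, ((t + 1 : ℕ) : ℤ) - ((i + 1 : ℕ) : ℤ) = (t : ℤ) - i := fun i => by
    push_cast; ring
  have h2 : ((t + 1 : ℕ) : ℤ) - ((0 : ℕ) : ℤ) = (t : ℤ) + 1 := by push_cast; ring
  rw [huv, Finset.sum_range_succ', Matrix.mulVec_sub, Matrix.mulVec_add, Matrix.mulVec_mulVec,
    Matrix.mulVec_mulVec, Matrix.mulVec_sum, h.compl_mul_comm, h2, pow_zero, Matrix.one_mul]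
  simp only [h1, Matrix.mulVec_mulVec, pow_succ', Matrix.mul_assoc]
  abel

theorem IsUnitSplitting.tendsto_initial (h : IsUnitSplitting A L R) {W ξ : Ω → ι → ℝ}
    (hW : Tendsto (fun N : ℕ => eLpNorm (fun ω => W ω -
      ∑ i ∈ Finset.range N, (A ^ i * (1 - L * R)) *ᵥ e (((0 : ℕ) : ℤ) - (i : ℤ)) ω) 2 μ)
      atTop (𝓝 0)) :
    Tendsto (fun N : ℕ => eLpNorm (fun ω => (1 - L * R) *ᵥ ((L * R) *ᵥ ξ ω + (1 - L * R) *ᵥ W ω) -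
      ∑ i ∈ Finset.range N, (A ^ i * (1 - L * R)) *ᵥ e (((0 : ℕ) : ℤ) - (i : ℤ)) ω) 2 μ)
      atTop (𝓝 0) := by
  refine (tendsto_eLpNorm_mulVec (1 - L * R) hW).congr fun N => ?_
  refine congrArg (eLpNorm · 2 μ) (funext fun ω => ?_)
  rw [Matrix.mulVec_sub, Matrix.mulVec_add, Matrix.mulVec_mulVec, Matrix.mulVec_mulVec,
    ← Matrix.mul_assoc, h.compl_mul_left, Matrix.zero_mul, Matrix.zero_mulVec, zero_add,
    h.compl_mul_compl, Matrix.mulVec_sum]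
  refine congrArg _ (Finset.sum_congr rfl fun i _ => ?_)
  rw [Matrix.mulVec_mulVec, ← Matrix.mul_assoc, h.compl_mul_pow, ← h.pow_mul_compl,
    Matrix.mul_assoc, h.compl_mul_compl]

/-- The initial value `L R ξ + (1 - L R) W` keeps the trend component of `ξ` and replaces the stable
one by the limit `W` of the moving average. -/
theorem IsUnitSplitting.exists_isEquilibriumSolution [IsProbabilityMeasure μ]
    (h : IsUnitSplitting A L R) (he : IsWhiteNoise μ e) {ξ : Ω → ι → ℝ} (hξ : MemLp ξ 2 μ) :
    ∃ x, IsEquilibriumSolution μ A L R e x ∧ ∀ ω, R *ᵥ x 0 ω = R *ᵥ ξ ω := by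
  obtain ⟨K, hK⟩ := he.exists_eLpNorm_le
  obtain ⟨W, hW, hWt⟩ := exists_tendsto_eLpNorm_sum h.decay_mul_compl
    (f := fun i => e (((0 : ℕ) : ℤ) - (i : ℤ))) (fun i => he.1 _) (fun i => hK _)
  have h0 : MemLp (fun ω => (L * R) *ᵥ ξ ω + (1 - L * R) *ᵥ W ω) 2 μ :=
    (hξ.matrix_mulVec (L * R)).add (hW.matrix_mulVec (1 - L * R))
  have hsol := isVAR1_varSolution (A := A) (e := e) h0
  refine ⟨_, ⟨hsol.memLp he.1, fun _ _ => rfl, fun t => ?_⟩, fun ω => ?_⟩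
  · induction t with
    | zero => exact h.tendsto_initial hWt
    | succ t ih => exact h.tendsto_step (fun _ => rfl) ih
  · rw [varSolution, Matrix.mulVec_add, Matrix.mulVec_mulVec, Matrix.mulVec_mulVec,
      h.right_mul_compl, Matrix.zero_mulVec, add_zero, ← Matrix.mul_assoc, h.right_mul_left,
      Matrix.one_mul]

namespace IsEquilibriumSolution

/-- The difference is `A ^ t` applied to `y 0 - x 0`. Equal trend components let `A ^ t` be replaced
by `A ^ t - L R`, which decays. -/
theorem tendsto_sub (hx : IsEquilibriumSolution μ A L R e x) (h : IsUnitSplitting A L R)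
    (hy : IsVAR1 μ A e y) (h0 : ∀ ω, R *ᵥ x 0 ω = R *ᵥ y 0 ω) :
    Tendsto (fun t => eLpNorm (fun ω => y t ω - x t ω) 2 μ) atTop (𝓝 0) := by
  refine (tendsto_eLpNorm_mulVec_of_decays h.decay (hy.1.sub (hx.memLp 0))).congr fun t => ?_
  refine eLpNorm_congr_ae ?_
  filter_upwards [hy.sub_ae_eq hx.isVAR1 t] with ω hω
  rw [hω, Matrix.sub_mulVec, ← Matrix.mulVec_mulVec, Pi.sub_apply, Matrix.mulVec_sub R, h0, sub_self,
    Matrix.mulVec_zero, sub_zero]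

theorem isI0_mulVec {γ : Type*} [Fintype γ] (hx : IsEquilibriumSolution μ A L R e x)
    (h : IsUnitSplitting A L R) {B : Matrix γ ι ℝ} (hB : B * L = 0) (hB0 : B ≠ 0) :
    IsI0 μ e fun t ω => B *ᵥ x t ω := by
  have hdecay : DecaysGeometrically fun i => B * (A ^ i * (1 - L * R)) :=
    h.decay_mul_compl.mul_left B
  -- The partial sums times `1 - A` telescope to `B - B A ^ N`, which tends to `B` because `B L =
  -- 0`. A zero sum would thus force `B = 0`.
  refine ⟨0, fun i => B * (A ^ i * (1 - L * R)), hdecay, fun hsum => hB0 ?_, fun t => ?_⟩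
  · have hs := hdecay.summable.hasSum.tendsto_sum_nat
    rw [hsum] at hs
    have h1 : Tendsto (fun N : ℕ =>
        (∑ i ∈ Finset.range N, B * (A ^ i * (1 - L * R))) * (1 - A)) atTop
        (𝓝 ((0 : Matrix γ ι ℝ) * (1 - A))) :=
      ((continuous_id.matrix_mul continuous_const).tendsto _).comp hs
    have h2 : ∀ N : ℕ, (∑ i ∈ Finset.range N, B * (A ^ i * (1 - L * R))) * (1 - A) =
        B - B * A ^ N := fun N => by
      induction N with
      | zero => simp
      | succ N ih =>
        have h3 := h.compl_mul_pow 1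
        rw [pow_one] at h3
        rw [Finset.sum_range_succ, Matrix.add_mul, ih, Matrix.mul_assoc, Matrix.mul_assoc,
          Matrix.mul_sub (1 - L * R), h3, Matrix.mul_one, sub_sub_sub_cancel_right, Matrix.mul_sub,
          Matrix.mul_one, ← pow_succ, Matrix.mul_sub]
        abel
    have h3 : Tendsto (fun N : ℕ => B * (A ^ N - L * R)) atTop (𝓝 (B * (0 : Matrix ι ι ℝ))) :=
      ((continuous_const.matrix_mul continuous_id).tendsto _).comp h.decay.tendsto_zero
    simp only [h2, Matrix.zero_mul] at h1
    simp only [Matrix.mul_sub, ← Matrix.mul_assoc, hB, Matrix.zero_mul, sub_zero,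
      Matrix.mul_zero] at h3
    have h4 := h1.add h3
    simp only [sub_add_cancel, add_zero] at h4
    exact tendsto_nhds_unique tendsto_const_nhds h4
  · simpa only [sub_zero] using hx.tendsto_mulVec hB t

/-- The difference is `(A - 1) x_t + e_{t+1}`, and `A - 1` sees only the stable component. The
partial sums of the coefficients telescope to `A ^ N`, with limit `L R`; this is nonzero since `R L
= 1` and `κ` is nonempty. -/
theorem isI1 [Nonempty κ] (hx : IsEquilibriumSolution μ A L R e x) (h : IsUnitSplitting A L R) :
    IsI1 μ e x := by
  let C : ℕ → Matrix ι ι ℝ := fun i => Nat.casesOn i 1 fun i => (A - 1) * (A ^ i * (1 - L * R))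
  have hC0 : C 0 = 1 := rfl
  have hC1 : ∀ i, C (i + 1) = (A - 1) * (A ^ i * (1 - L * R)) := fun i => rfl
  have hdecay : DecaysGeometrically C := by
    obtain ⟨c, -, hc⟩ := (C 0).exists_abs_le
    exact DecaysGeometrically.of_tail (h.decay_mul_compl.mul_left (A - 1)) hc
  have hsum : ∀ N, ∑ i ∈ Finset.range (N + 1), C i = A ^ N := fun N => by
    induction N with
    | zero => simp [hC0]
    | succ N ih =>
      rw [Finset.sum_range_succ, ih, hC1, h.pow_mul_compl, ← h.compl_mul_pow, ← Matrix.mul_assoc,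
        h.sub_one_mul_compl, Matrix.sub_mul, Matrix.one_mul, ← pow_succ']
      abel
  refine ⟨0, C, hdecay, fun hzero => ?_, fun t => ?_⟩
  · have hs := (tendsto_add_atTop_iff_nat 1).2 hdecay.summable.hasSum.tendsto_sum_nat
    simp only [hsum, hzero] at hs
    have h1 := hs.sub h.decay.tendsto_zero
    simp only [sub_sub_cancel, sub_zero] at h1
    have h2 : L * R = 0 := tendsto_nhds_unique tendsto_const_nhds h1
    have h3 : (1 : Matrix κ κ ℝ) = 0 := by
      rw [← Matrix.one_mul 1, ← h.right_mul_left, Matrix.mul_assoc, ← Matrix.mul_assoc L, h2,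
        Matrix.zero_mul, Matrix.mul_zero]
    exact one_ne_zero h3
  · rw [← tendsto_add_atTop_iff_nat 1]
    refine (tendsto_eLpNorm_mulVec (A - 1) (hx.tendsto t)).congr fun N => ?_
    refine congrArg (eLpNorm · 2 μ) (funext fun ω => ?_)
    have h4 : ∀ i : ℕ, (t : ℤ) - ((i + 1 : ℕ) : ℤ) + 1 = (t : ℤ) - i := fun i => by
      push_cast; ring
    dsimp only
    rw [hx.recursion, Finset.sum_range_succ', Matrix.mulVec_sub, Matrix.mulVec_mulVec,
      h.sub_one_mul_compl, Matrix.mulVec_sum, hC0, Matrix.sub_mulVec]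
    simp only [hC1, h4, Matrix.mulVec_mulVec, Matrix.one_mulVec, Nat.cast_zero, sub_zero]
    abel

theorem hasCommonTrends [IsProbabilityMeasure μ] {k : ℕ} {L : Matrix ι (Fin k) ℝ}
    {R : Matrix (Fin k) ι ℝ} (hx : IsEquilibriumSolution μ A L R e x) (h : IsUnitSplitting A L R)
    (he : IsWhiteNoise μ e) : HasCommonTrends μ x k := by
  -- `L` is a right inverse of `R`; this keeps the covariance of the increments `R e` positive
  -- definite.
  have hR : Function.Injective R.vecMul := fun v w hvw => by
    have := congrArg (· ᵥ* L) hvw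
    simpa [Matrix.vecMul_vecMul, h.right_mul_left] using this
  refine ⟨L, fun t ω => R *ᵥ x t ω, fun t ω => R *ᵥ e ((t : ℤ) + 1) ω,
    fun t ω => (1 - L * R) *ᵥ x t ω, by simpa using h.rank_left, (hx.memLp 0).matrix_mulVec R,
    fun t => Eventually.of_forall fun ω => ?_,
    he.mulVec_comp (φ := fun t : ℕ => (t : ℤ) + 1) (fun s t hst => by simpa using hst) hR,
    hx.isWeaklyStationary_mulVec he h.compl_mul_left, fun t => Eventually.of_forall fun ω => ?_⟩
  · dsimp only
    rw [hx.recursion, Matrix.mulVec_add, Matrix.mulVec_mulVec, h.right_mul]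
  · dsimp only
    rw [Matrix.mulVec_mulVec, ← Matrix.add_mulVec, add_sub_cancel, Matrix.one_mulVec]

/-- For an arbitrary solution, the stable component differs from the stationary one by a bounded
transient. -/
theorem exists_eLpNorm_compl_mulVec_le [IsProbabilityMeasure μ]
    (hx : IsEquilibriumSolution μ A L R e x) (h : IsUnitSplitting A L R) (he : IsWhiteNoise μ e)
    (hy : IsVAR1 μ A e y) :
    ∃ K : NNReal, ∀ t, eLpNorm (fun ω => (1 - L * R) *ᵥ y t ω) 2 μ ≤ K := by
  obtain ⟨K, hK⟩ := (hx.isWeaklyStationary_mulVec he h.compl_mul_left).exists_eLpNorm_le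
  obtain ⟨M, ρ, hM, h0, h1, hdecay⟩ := h.decay.exists_pos
  have hz : MemLp (fun ω => y 0 ω - x 0 ω) 2 μ := hy.1.sub (hx.memLp 0)
  refine ⟨K + (Fintype.card ι * M).toNNReal * (eLpNorm (fun ω => y 0 ω - x 0 ω) 2 μ).toNNReal,
    fun t => ?_⟩
  have hsplit : (fun ω => (1 - L * R) *ᵥ y t ω) =ᵐ[μ]
      (fun ω => (1 - L * R) *ᵥ x t ω) + fun ω => (A ^ t - L * R) *ᵥ (y 0 ω - x 0 ω) := by
    filter_upwards [hy.sub_ae_eq hx.isVAR1 t] with ω hω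
    rw [Pi.add_apply, ← h.compl_mul_pow, ← Matrix.mulVec_mulVec, ← hω, ← Matrix.mulVec_add,
      add_sub_cancel]
  rw [eLpNorm_congr_ae hsplit]
  refine (eLpNorm_add_le ((hx.memLp t).matrix_mulVec _).1 (hz.matrix_mulVec (A ^ t - L * R)).1
    one_le_two).trans ?_
  push_cast
  refine add_le_add (hK t) ?_
  rw [ENNReal.coe_toNNReal hz.eLpNorm_ne_top]
  exact eLpNorm_mulVec_le _ hM (fun a b => (hdecay t a b).trans
    (mul_le_of_le_one_right hM (pow_le_one₀ h0 h1.le))) _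

/-- If `b' y_t` is weakly stationary for some solution `y`, then `b` is orthogonal to the fixed
vectors of `A`. -/
theorem vecMul_eq_zero [IsProbabilityMeasure μ] (hx : IsEquilibriumSolution μ A L R e x)
    (h : IsUnitSplitting A L R) (he : IsWhiteNoise μ e) (hy : IsVAR1 μ A e y) {b : ι → ℝ}
    (hb : IsWeaklyStationary μ (linComb b y)) : b ᵥ* L = 0 := by
  obtain ⟨K₁, hK₁⟩ := hb.exists_eLpNorm_le
  obtain ⟨K₂, hK₂⟩ := hx.exists_eLpNorm_compl_mulVec_le h he hy
  -- As `c' A = c'`, the process `c' y` is a random walk; it equals `b' y - b' (1 - L R) y`, a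
  -- difference of two processes bounded in mean square.
  set c : ι → ℝ := b ᵥ* (L * R) with hc
  have hcA : ∀ v, c ⬝ᵥ (A *ᵥ v) = c ⬝ᵥ v := fun v => by
    rw [Matrix.dotProduct_mulVec, hc, Matrix.vecMul_vecMul, Matrix.mul_assoc, h.right_mul]
  have hsum : ∀ t : ℕ, ∀ᵐ ω ∂μ,
      c ⬝ᵥ y t ω = c ⬝ᵥ y 0 ω + ∑ s ∈ Finset.range t, c ⬝ᵥ e ((s : ℤ) + 1) ω := fun t => by
    induction t with
    | zero => simp
    | succ t ih =>
      filter_upwards [ih, hy.2 t] with ω h1 h2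
      rw [h2, dotProduct_add, hcA, h1, Finset.sum_range_succ, add_assoc]
  have hmemdot : ∀ (v : ι → ℝ) {f : Ω → ι → ℝ}, MemLp f 2 μ → MemLp (fun ω => v ⬝ᵥ f ω) 2 μ :=
    fun v f hf => (hf.matrix_mulVec (Matrix.of fun _ : Unit => v)).coord ()
  obtain ⟨β, hβ, hbβ⟩ := (Matrix.of fun _ : Unit => b).exists_abs_le
  have hyt := hy.memLp he.1
  have hc0 : c = 0 := by
    have he' : IsWhiteNoise μ fun (s : ℕ) ω => e ((s : ℤ) + 1) ω := by
      have := he.mulVec_comp (φ := fun t : ℕ => (t : ℤ) + 1) (fun s t hst => by simpa using hst)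
        (R := (1 : Matrix ι ι ℝ)) (fun v w hvw => by simpa using hvw)
      simpa only [Matrix.one_mulVec] using this
    refine he'.eq_zero_of_bounded_sum (c := c) (K := K₁ + (Fintype.card ι * β).toNNReal * K₂ +
      (eLpNorm (fun ω => c ⬝ᵥ y 0 ω) 2 μ).toNNReal) fun t => ?_
    have hsplit : (fun ω => ∑ s ∈ Finset.range t, c ⬝ᵥ e ((s : ℤ) + 1) ω) =ᵐ[μ]
        (fun ω => b ⬝ᵥ y t ω) - (fun ω => b ⬝ᵥ ((1 - L * R) *ᵥ y t ω)) -
          fun ω => c ⬝ᵥ y 0 ω := by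
      filter_upwards [hsum t] with ω hω
      rw [Pi.sub_apply, Pi.sub_apply, Matrix.sub_mulVec, Matrix.one_mulVec, dotProduct_sub,
        sub_sub_cancel, Matrix.dotProduct_mulVec, ← hc, hω, add_sub_cancel_left]
    have hm1 := hmemdot b (hyt t)
    have hm2 := hmemdot b ((hyt t).matrix_mulVec (1 - L * R))
    have hm3 := hmemdot c (hyt 0)
    rw [eLpNorm_congr_ae hsplit]
    refine (eLpNorm_sub_le (hm1.sub hm2).1 hm3.1 one_le_two).trans ?_
    push_cast
    rw [ENNReal.coe_toNNReal hm3.eLpNorm_ne_top]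
    refine add_le_add ((eLpNorm_sub_le hm1.1 hm2.1 one_le_two).trans (add_le_add ?_ ?_)) le_rfl
    · exact (eLpNorm_mono fun ω => norm_le_pi_norm (linComb b y t ω) ()).trans (hK₁ t)
    · refine (eLpNorm_mono fun ω =>
        norm_le_pi_norm ((Matrix.of fun _ : Unit => b) *ᵥ ((1 - L * R) *ᵥ y t ω)) ()).trans ?_
      refine (eLpNorm_mulVec_le _ hβ hbβ _).trans ?_
      exact mul_le_mul' le_rfl (hK₂ t)
  rw [← Matrix.mul_one L, ← h.right_mul_left, ← Matrix.mul_assoc, ← Matrix.vecMul_vecMul, ← hc, hc0,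
    Matrix.zero_vecMul]

/-- The one solution `x` serves all `b` with `b' L = 0`, which is why these vectors form a linear
space. -/
theorem cointegratingVectors_eq [IsProbabilityMeasure μ] (hx : IsEquilibriumSolution μ A L R e x)
    (h : IsUnitSplitting A L R) (he : IsWhiteNoise μ e) :
    cointegratingVectors μ {y | IsVAR1 μ A e y} = {b | b ᵥ* L = 0} := by
  ext b
  refine ⟨fun ⟨y, hy, hb⟩ => hx.vecMul_eq_zero h he hy hb, fun hb => ⟨x, hx.isVAR1, ?_⟩⟩
  exact hx.isWeaklyStationary_mulVec he (B := Matrix.of fun _ : Unit => b)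
    (funext fun _ => hb)

theorem isI0_linComb (hx : IsEquilibriumSolution μ A L R e x) (h : IsUnitSplitting A L R)
    {b : ι → ℝ} (hb : b ᵥ* L = 0) (hb0 : b ≠ 0) : IsI0 μ e (linComb b x) :=
  hx.isI0_mulVec h (B := Matrix.of fun _ : Unit => b) (funext fun _ => hb)
    fun h0 => hb0 (congrFun h0 ())

theorem hasCointegrationRank [IsProbabilityMeasure μ] (hx : IsEquilibriumSolution μ A L R e x)
    (h : IsUnitSplitting A L R) (he : IsWhiteNoise μ e) :
    HasCointegrationRank μ {y | IsVAR1 μ A e y} (Fintype.card ι - Fintype.card κ) := by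
  refine ⟨LinearMap.ker Lᵀ.mulVecLin, ?_, ?_⟩
  · rw [hx.cointegratingVectors_eq h he]
    ext b
    simp
  · have := h.finrank_ker_transpose_add
    omega

end IsEquilibriumSolution

end VAR

/-! ### Matrix autoregressive processes -/

theorem vecProcess_surjective {Ω : Type*} {m n : ℕ} (x : ℕ → Ω → (Fin n × Fin m → ℝ)) :
    ∃ X : ℕ → Ω → Matrix (Fin m) (Fin n) ℝ, x = vecProcess X :=
  ⟨fun t ω => Matrix.of fun i j => x t ω (j, i), rfl⟩

section MAR

variable {Ω : Type*} [MeasurableSpace Ω] {μ : Measure Ω} {m n : ℕ}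
  {Λ : Matrix (Fin m) (Fin m) ℝ} {Ψ : Matrix (Fin n) (Fin n) ℝ}
  {E : ℤ → Ω → Matrix (Fin m) (Fin n) ℝ}

theorem isMAR1_iff_isVAR1 {X : ℕ → Ω → Matrix (Fin m) (Fin n) ℝ} :
    IsMAR1 μ Λ Ψ E X ↔ IsVAR1 μ (Ψ ⊗ₖ Λ) (vecProcess E) (vecProcess X) := by
  refine and_congr Iff.rfl (forall_congr' fun t => eventually_congr (Eventually.of_forall
    fun ω => ?_))
  simp only [vecProcess]
  rw [Matrix.kronecker_mulVec_vec, ← Matrix.vec_add, Matrix.vec_inj]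

theorem setOf_vecProcess_isMAR1 :
    {x | ∃ Y, IsMAR1 μ Λ Ψ E Y ∧ x = vecProcess Y} =
      {x | IsVAR1 μ (Ψ ⊗ₖ Λ) (vecProcess E) x} := by
  ext x
  constructor
  · rintro ⟨Y, hY, rfl⟩
    exact isMAR1_iff_isVAR1.1 hY
  · intro hx
    obtain ⟨Y, rfl⟩ := vecProcess_surjective x
    exact ⟨Y, isMAR1_iff_isVAR1.2 hx, rfl⟩

/-- The Kronecker product of two matrices with stable eigenvalues apart from a semisimple unit
eigenvalue splits in the same way. -/
theorem exists_isUnitSplitting_kronecker {k₁ k₂ : ℕ} (hΛ : HasSemisimpleUnitEigenvalue Λ k₁)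
    (hΨ : HasSemisimpleUnitEigenvalue Ψ k₂) (hΛs : OtherEigenvaluesStable Λ)
    (hΨs : OtherEigenvaluesStable Ψ) :
    ∃ (L : Matrix (Fin n × Fin m) (Fin (k₁ * k₂)) ℝ) (R : Matrix (Fin (k₁ * k₂)) (Fin n × Fin m) ℝ),
      IsUnitSplitting (Ψ ⊗ₖ Λ) L R := by
  obtain ⟨L₁, R₁, h₁⟩ := exists_isUnitSplitting hΛ hΛs
  obtain ⟨L₂, R₂, h₂⟩ := exists_isUnitSplitting hΨ hΨs
  -- Column stacking puts the `Ψ` factor first, so the two index factors are swapped.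
  exact ⟨_, _, (h₂.kronecker h₁).reindex (finProdFinEquiv.symm.trans (Equiv.prodComm _ _))⟩

end MAR

theorem theoremT01 {Ω : Type*} [MeasurableSpace Ω] (μ : Measure Ω) [IsProbabilityMeasure μ]
    (m n r₁ r₂ : ℕ) (hr₁ : 0 < r₁) (hr₁m : r₁ < m) (hr₂ : 0 < r₂) (hr₂n : r₂ < n)
    (Λ : Matrix (Fin m) (Fin m) ℝ) (Ψ : Matrix (Fin n) (Fin n) ℝ)
    (hΛ : HasSemisimpleUnitEigenvalue Λ (m - r₁)) (hΨ : HasSemisimpleUnitEigenvalue Ψ (n - r₂))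
    (hΛs : OtherEigenvaluesStable Λ) (hΨs : OtherEigenvaluesStable Ψ)
    (E : ℤ → Ω → Matrix (Fin m) (Fin n) ℝ) (hE : IsWhiteNoise μ (vecProcess E))
    (X : ℕ → Ω → Matrix (Fin m) (Fin n) ℝ) (hX : IsMAR1 μ Λ Ψ E X) :
    -- after a suitable choice of the initial value, which alters the process only by a
    -- transient, the vectorized process is I(1) with common trends and equilibrium relations
    (∃ X' : ℕ → Ω → Matrix (Fin m) (Fin n) ℝ, IsMAR1 μ Λ Ψ E X' ∧
      Tendsto (fun t => eLpNorm (fun ω => vecProcess X t ω - vecProcess X' t ω) 2 μ) atTop (𝓝 0) ∧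
      IsI1 μ (vecProcess E) (vecProcess X') ∧
      HasCommonTrends μ (vecProcess X') ((m - r₁) * (n - r₂)) ∧
      ∀ b ∈ cointegratingVectors μ {x | ∃ Y, IsMAR1 μ Λ Ψ E Y ∧ x = vecProcess Y}, b ≠ 0 →
        IsI0 μ (vecProcess E) (linComb b (vecProcess X'))) ∧
    -- the cointegration rank, which is also the rank of the impact matrix of the
    -- error-correction form of the vectorized process
    HasCointegrationRank μ {x | ∃ Y, IsMAR1 μ Λ Ψ E Y ∧ x = vecProcess Y}
      (m * n - (m - r₁) * (n - r₂)) ∧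
    (Ψ ⊗ₖ Λ - 1).rank = m * n - (m - r₁) * (n - r₂) ∧
    m * n - (m - r₁) * (n - r₂) = n * r₁ + m * r₂ - r₁ * r₂ ∧
    0 < m * n - (m - r₁) * (n - r₂) := by
  obtain ⟨L, R, h⟩ := exists_isUnitSplitting_kronecker hΛ hΨ hΛs hΨs
  have hXv := isMAR1_iff_isVAR1.1 hX
  obtain ⟨x, hx, hx0⟩ := h.exists_isEquilibriumSolution hE hXv.1
  obtain ⟨X', rfl⟩ := vecProcess_surjective x
  -- The additive form, with `m = r₁ + p + 1` and `n = r₂ + q + 1`, controls the truncated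
  -- subtractions.
  have hle : (m - r₁) * (n - r₂) + (n * r₁ + m * r₂ - r₁ * r₂) = m * n := by
    obtain ⟨p, rfl⟩ := Nat.exists_eq_add_of_lt hr₁m
    obtain ⟨q, rfl⟩ := Nat.exists_eq_add_of_lt hr₂n
    rw [show r₁ + p + 1 - r₁ = p + 1 by omega, show r₂ + q + 1 - r₂ = q + 1 by omega,
      show (r₂ + q + 1) * r₁ + (r₁ + p + 1) * r₂ - r₁ * r₂ =
        (r₂ + q + 1) * r₁ + (p + 1) * r₂ from Nat.sub_eq_of_eq_add (by ring)]
    ring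
  have hpos : r₁ * r₂ < n * r₁ + m * r₂ := by nlinarith
  have hcard : Fintype.card (Fin n × Fin m) - Fintype.card (Fin ((m - r₁) * (n - r₂))) =
      m * n - (m - r₁) * (n - r₂) := by
    rw [Fintype.card_prod, Fintype.card_fin, Fintype.card_fin, Fintype.card_fin, mul_comm n m]
  -- At least one trend: this supplies the nonempty index type that `isI1` needs.
  have : NeZero ((m - r₁) * (n - r₂)) :=
    ⟨(Nat.mul_pos (Nat.sub_pos_of_lt hr₁m) (Nat.sub_pos_of_lt hr₂n)).ne'⟩
  rw [setOf_vecProcess_isMAR1]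
  refine ⟨⟨X', isMAR1_iff_isVAR1.2 hx.isVAR1, hx.tendsto_sub h hXv hx0, hx.isI1 h,
    hx.hasCommonTrends h hE, fun b hb hb0 => ?_⟩, hcard ▸ hx.hasCointegrationRank h hE, ?_,
    by omega, by omega⟩
  · rw [hx.cointegratingVectors_eq h hE] at hb
    exact hx.isI0_linComb h hb hb0
  · have := h.rank_sub_one_add
    omega
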